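/- Let $P=P^3(4)=[-1,1]^2\times[-1,1]$ be the 4-sided prism, and let $e_1,e_2,e_3$ be the standard basis of $(\mathbb Z_2)^3$. A $(\mathbb Z_2)^3$-coloring $\lambda$ of $P$ assigns to each facet an element of $(\mathbb Z_2)^3$ such that the colors of the facets meeting at each vertex are linearly independent; a facet is called 2-independent if the colors of its neighboring facets span a 2-dimensional subspace. The small cover $M(P,\lambda)$ is the quotient of $P\times(\mathbb Z_2)^3$ by $(x,g)\sim(y,h)\iff x=y$ and $g-h$ lies in the subgroup generated by the colors of the facets containing $x$; $(\mathbb Z_2)^3$ acts on it by translation of the second factor. Define six colorings $\tau_1,\dots,\tau_6$ of $P$ as follows. The four side facets, in cyclic order, have colors $e_1,e_2,e_1,e_2$ for $j=1,2,3$ and $e_1,e_2,e_1+e_2,e_2$ for $j=4,5,6$; the bottom facet always has color $e_3$; the top facet has color $e_3+e_1$ for $j=1,4$, color $e_3+e_2$ for $j=2,5$, and color $e_3+e_1+e_2$ for $j=3,6$. For a homeomorphism $f:F\to F$, the $F$-bundle over $S^1$ with monodromy $f$ is $F\times[-1,1]/(x,1)\sim(f(x),-1)$ with projection $[x,t]\mapsto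 e^{\pi i t}$. Let $T=S^1\times S^1$, where $A\in \mathrm{GL}(2,\mathbb Z)$ with rows $(a,b),(c,d)$ acts by $(z_1,z_2)\mapsto(z_1^az_2^b,z_1^cz_2^d)$, and let $K=S^1\times S^1/(z_1,z_2)\sim(-z_1,\bar z_2)$ be the Klein bottle, with $f_{\epsilon_1,\epsilon_2}([z_1,z_2])=[z_1^{\epsilon_1},z_2^{\epsilon_2}]$ for $\epsilon_1,\epsilon_2=\pm1$. Then: (0) Each $\tau_j$ is a $(\mathbb Z_2)^3$-coloring whose top and bottom facets are 2-independent and differently colored, and every such coloring of $P$ equals some $\tau_j$ up to an automorphism in $\mathrm{GL}(3,\mathbb Z_2)$ of the colors and a rotation of the side facets. (1) $M(P,\tau_j)$, $j=1,2,3$, is $(\mathbb Z_2)^3$-equivariantly homeomorphic to the (locally trivial) $T$-bundle over $S^1$ with monodromy $\begin{pmatrix}-1&0\\0&1\end{pmatrix}$, $\begin{pmatrix}1&0\\0&-1\end{pmatrix}$, $\begin{pmatrix}-1&0\\0&-1\end{pmatrix}$, respectively, with the $(\mathbb Z_2)^3$-action induced by the action on $T\times[-1,1]$ in which $e_1,e_2,e_3$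 act by $t_1(z_1,z_2,t)=(\bar z_1,z_2,t)$, $t_2(z_1,z_2,t)=(z_1,\bar z_2,t)$, $t_3(z_1,z_2,t)=(z_1,z_2,-t)$. (2) $M(P,\tau_j)$, $j=4,5,6$, is $(\mathbb Z_2)^3$-equivariantly homeomorphic to the (locally trivial) $K$-bundle over $S^1$ with monodromy $f_{-1,1}$, $f_{1,-1}$, $f_{-1,-1}$, respectively, with the $(\mathbb Z_2)^3$-action induced by the action on $K\times[-1,1]$ in which $e_1,e_2,e_3$ act by $t_1([z_1,z_2],t)=([\bar z_1,z_2],t)$, $t_2([z_1,z_2],t)=([z_1,\bar z_2],t)$, $t_3([z_1,z_2],t)=([z_1,z_2],-t)$. (3) The three $T$-bundles in (1) and the $K$-bundles with monodromy $f_{-1,1}$ and $f_{-1,-1}$ in (2) are nontrivial, i.e. not isomorphic over $S^1$ to the product bundle. -/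

import Mathlib

open Topology

noncomputable section

/-! ## Colorings and the reconstruction of small covers -/

/-- The group `(ℤ₂)³`, written additively; it carries the discrete topology
(the product of three discrete two-point spaces). -/
abbrev Z23 : Type := Fin 3 → ZMod 2

/-- The standard basis `e₁, e₂, e₃` of `(ℤ₂)³`, indexed by `0, 1, 2`. -/
def basisVec (i : Fin 3) : Z23 := Pi.single i 1

section Reconstruction

variable {X ι : Type} (facet : ι → Set X) (lam : ι → Z23)

/-- A `(ℤ₂)³`-coloring of a simple 3-polytope `X` with facets `facet i`: the colors of the facets
meeting at a point are linearly independent. (Every nonempty face has a vertex, so it amounts to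
the same to ask this at the vertices only; in particular all colors are nonzero.) -/
def IsColoring : Prop :=
  ∀ x : X, LinearIndependent (ZMod 2) (fun i : {i : ι // x ∈ facet i} => lam i)

/-- The facet `i` is 2-independent: the colors of the neighboring facets around it span a
2-dimensional subspace of `(ℤ₂)³`. -/
def IsTwoIndependent (i : ι) : Prop :=
  Module.finrank (ZMod 2)
    (Submodule.span (ZMod 2) (lam '' {j | j ≠ i ∧ (facet i ∩ facet j).Nonempty})) = 2

/-- The subgroup `G_F` of `(ℤ₂)³` generated by the colors of the facets that contain `x`,
i.e. of the facets whose intersection is the face `F` with `x` in its relative interior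
(the trivial subgroup for `x` in the interior of the polytope). -/
def faceGroup (x : X) : Submodule (ZMod 2) Z23 :=
  Submodule.span (ZMod 2) (lam '' {i | x ∈ facet i})

/-- The equivalence relation `(x, g) ∼ (y, h) ↔ x = y ∧ g - h ∈ G_F` on `X × (ℤ₂)³`. -/
def smallCoverSetoid : Setoid (X × Z23) where
  r p q := p.1 = q.1 ∧ p.2 - q.2 ∈ faceGroup facet lam p.1
  iseqv :=
    { refl := fun p => ⟨rfl, by simp⟩
      symm := fun {p q} h => ⟨h.1.symm, by
        have h2 := (faceGroup facet lam p.1).neg_mem h.2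
        rw [neg_sub] at h2
        rwa [← h.1]⟩
      trans := fun {p q r} h k => ⟨h.1.trans k.1, by
        have k2 := k.2
        rw [← h.1] at k2
        have := (faceGroup facet lam p.1).add_mem h.2 k2
        rwa [sub_add_sub_cancel] at this⟩ }

/-- The small cover `M(X, λ) = X × (ℤ₂)³ / ∼` reconstructed from the colored polytope. -/
def SmallCover : Type := Quotient (smallCoverSetoid facet lam)

instance smallCoverTopology [TopologicalSpace X] : TopologicalSpace (SmallCover facet lam) :=
  inferInstanceAs (TopologicalSpace (Quotient (smallCoverSetoid facet lam)))

/-- The `(ℤ₂)³`-action on `M(X, λ)`: `g + [x, h] = [x, g + h]`. -/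
instance smallCoverAction : AddAction Z23 (SmallCover facet lam) where
  vadd g := Quotient.map (fun p => (p.1, g + p.2)) (fun p q h => ⟨h.1, by
    change (g + p.2) - (g + q.2) ∈ faceGroup facet lam p.1
    rw [add_sub_add_left_eq_sub]
    exact h.2⟩)
  zero_vadd := by
    rintro ⟨x, h⟩
    exact congrArg (Quotient.mk (smallCoverSetoid facet lam)) (Prod.ext rfl (zero_add h))
  add_vadd := by
    rintro g g' ⟨x, h⟩
    exact congrArg (Quotient.mk (smallCoverSetoid facet lam)) (Prod.ext rfl (add_assoc g g' h))

end Reconstruction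

/-! ## The 4-sided prism and its colorings -/

/-- The 4-sided prism `P³(4)`: (square) × (interval), realized as `[-1,1]² × [-1,1]`. -/
def Prism4 : Type := {x : Fin 3 → ℝ // ∀ i, x i ∈ Set.Icc (-1 : ℝ) 1}

instance : TopologicalSpace Prism4 :=
  inferInstanceAs (TopologicalSpace {x : Fin 3 → ℝ // ∀ i, x i ∈ Set.Icc (-1 : ℝ) 1})

/-- The six facets of the 4-sided prism. -/
inductive PrismFacet : Type
  | side (k : Fin 4)
  | bottom
  | top

/-- The facets as subsets of the prism; the sides are numbered in cyclic order. -/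
def prismFacet : PrismFacet → Set Prism4
  | .side 0 => {x | x.1 0 = 1}
  | .side 1 => {x | x.1 1 = 1}
  | .side 2 => {x | x.1 0 = -1}
  | .side 3 => {x | x.1 1 = -1}
  | .bottom => {x | x.1 2 = -1}
  | .top => {x | x.1 2 = 1}

/-- The facet permutation induced by rotating the prism by `r` quarter turns about its axis. -/
def rotateFacet (r : Fin 4) : PrismFacet → PrismFacet
  | .side k => .side (k + r)
  | .bottom => .bottom
  | .top => .top

/-- The coloring with given colors of the four sides (in cyclic order), the bottom and the top. -/
def mkColoring (s : Fin 4 → Z23) (b t : Z23) : PrismFacet → Z23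
  | .side k => s k
  | .bottom => b
  | .top => t

/-- The six colorings `τ₁, …, τ₆` (indexed by `0, …, 5`). The bottom has color `e₃` throughout.
For `τ₁, τ₂, τ₃` the sides are colored `e₁, e₂, e₁, e₂`; for `τ₄, τ₅, τ₆` they are colored
`e₁, e₂, e₁ + e₂, e₂`. In both groups the top has color `e₃ + e₁`, `e₃ + e₂`, `e₃ + e₁ + e₂`. -/
def tau : Fin 6 → PrismFacet → Z23 :=
  let e₁ := basisVec 0
  let e₂ := basisVec 1
  let e₃ := basisVec 2
  ![mkColoring ![e₁, e₂, e₁, e₂] e₃ (e₃ + e₁),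
    mkColoring ![e₁, e₂, e₁, e₂] e₃ (e₃ + e₂),
    mkColoring ![e₁, e₂, e₁, e₂] e₃ (e₃ + e₁ + e₂),
    mkColoring ![e₁, e₂, e₁ + e₂, e₂] e₃ (e₃ + e₁),
    mkColoring ![e₁, e₂, e₁ + e₂, e₂] e₃ (e₃ + e₂),
    mkColoring ![e₁, e₂, e₁ + e₂, e₂] e₃ (e₃ + e₁ + e₂)]

/-- A coloring of the 4-sided prism whose top and bottom facets are both 2-independent and are
differently colored. -/
def IsTwistColoring (lam : PrismFacet → Z23) : Prop :=
  IsColoring prismFacet lam ∧ IsTwoIndependent prismFacet lam .top ∧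
    IsTwoIndependent prismFacet lam .bottom ∧ lam .top ≠ lam .bottom

/-! ## Bundles over the circle with given monodromy -/

/-- The interval `[-1, 1]`. -/
abbrev SymmInterval : Type := Set.Icc (-1 : ℝ) 1

/-- The reflection `t ↦ -t` of `[-1, 1]`. -/
def reflect (t : SymmInterval) : SymmInterval :=
  ⟨-t.1, by linarith [t.2.2], by linarith [t.2.1]⟩

section MappingTorus

variable {F : Type} [TopologicalSpace F]

/-- The gluing `(x, 1) ∼ (f x, -1)` of the two ends of `F × [-1, 1]`. -/
inductive GlueEnds (f : F ≃ₜ F) : F × SymmInterval → F × SymmInterval → Prop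
  | glue (x : F) : GlueEnds f (x, ⟨1, by norm_num⟩) (f x, ⟨-1, by norm_num⟩)

/-- The total space `F × [-1, 1] / (x, 1) ∼ (f x, -1)` of the `F`-bundle over the circle with
monodromy `f` (`Quot` is the quotient by the generated equivalence relation). -/
def MappingTorus (f : F ≃ₜ F) : Type := Quot (GlueEnds f)

instance (f : F ≃ₜ F) : TopologicalSpace (MappingTorus f) :=
  inferInstanceAs (TopologicalSpace (Quot (GlueEnds f)))

/-- The class `[x, t]` in the mapping torus. -/
def MappingTorus.mk (f : F ≃ₜ F) (p : F × SymmInterval) : MappingTorus f := Quot.mk _ p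

/-- The bundle projection `[x, t] ↦ exp (π i t)` onto the circle. -/
def MappingTorus.proj (f : F ≃ₜ F) : MappingTorus f → Circle :=
  Quot.lift (fun p => Circle.exp (Real.pi * p.2.1)) (by
    rintro _ _ ⟨x⟩
    apply Circle.ext
    simp)

/-- The three involutions of `F × [-1, 1]` given by two involutions `c₁, c₂` of the fibre and the
reflection of the interval: `t₁ = c₁ × id`, `t₂ = c₂ × id`, `t₃ = id × (t ↦ -t)`. -/
def cylinderInvolution (c₁ c₂ : F → F) : Fin 3 → F × SymmInterval → F × SymmInterval :=
  ![fun p => (c₁ p.1, p.2), fun p => (c₂ p.1, p.2), fun p => (p.1, reflect p.2)]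

/-- The small cover of the colored prism is equivariantly homeomorphic to the `F`-bundle over the
circle with monodromy `f`: the mapping torus of `f` is a locally trivial bundle with fibre `F`
over the circle, it carries a `(ℤ₂)³`-action that is induced by the action on `F × [-1, 1]` in
which `e₁, e₂, e₃` act by `t₁, t₂, t₃`, and there is an equivariant homeomorphism. -/
def IsEquivariantBundle (lam : PrismFacet → Z23) (c₁ c₂ : F → F) (f : F ≃ₜ F) : Prop :=
  (∀ b : Circle, ∃ e : Bundle.Trivialization F (MappingTorus.proj f), b ∈ e.baseSet) ∧
  ∃ act : AddAction Z23 (MappingTorus f),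
    (∀ (i : Fin 3) (p : F × SymmInterval),
      act.vadd (basisVec i) (MappingTorus.mk f p) =
        MappingTorus.mk f (cylinderInvolution c₁ c₂ i p)) ∧
    ∃ Φ : SmallCover prismFacet lam ≃ₜ MappingTorus f,
      ∀ (g : Z23) (m : SmallCover prismFacet lam), Φ (g +ᵥ m) = act.vadd g (Φ m)

/-- The `F`-bundle over the circle with monodromy `f` is nontrivial: it is not isomorphic, over
the circle, to the product bundle. -/
def IsNontrivialBundle (f : F ≃ₜ F) : Prop :=
  ¬ IsHomeomorphicTrivialFiberBundle F (MappingTorus.proj f)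

end MappingTorus

/-! ## The torus -/

/-- The torus `T = S¹ × S¹`. -/
abbrev Torus : Type := Circle × Circle

/-- The map `(z₁, z₂) ↦ (z₁ᵃ z₂ᵇ, z₁ᶜ z₂ᵈ)` of the torus given by an integer matrix with rows
`(a, b)` and `(c, d)`, which is its effect on `H₁(T; ℤ) = ℤ²`. -/
def torusMatrixMap (A : Matrix (Fin 2) (Fin 2) ℤ) (z : Torus) : Torus :=
  (z.1 ^ A 0 0 * z.2 ^ A 0 1, z.1 ^ A 1 0 * z.2 ^ A 1 1)

theorem torusMatrixMap_mul (A B : Matrix (Fin 2) (Fin 2) ℤ) (z : Torus) :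
    torusMatrixMap A (torusMatrixMap B z) = torusMatrixMap (A * B) z := by
  simp only [torusMatrixMap, Matrix.mul_apply, Fin.sum_univ_two, mul_zpow, ← zpow_mul, zpow_add]
  ext1
  all_goals
    simp only [mul_comm (B _ _)]
    exact mul_mul_mul_comm _ _ _ _

theorem torusMatrixMap_one (z : Torus) : torusMatrixMap 1 z = z := by
  simp [torusMatrixMap]

theorem continuous_torusMatrixMap (A : Matrix (Fin 2) (Fin 2) ℤ) : Continuous (torusMatrixMap A) := by
  unfold torusMatrixMap
  fun_prop

/-- The homeomorphism of the torus that represents the mapping class of `A ∈ GL(2, ℤ)`. -/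
def torusHomeo (A : GL (Fin 2) ℤ) : Torus ≃ₜ Torus where
  toFun := torusMatrixMap A.1
  invFun := torusMatrixMap A⁻¹.1
  left_inv z := by rw [torusMatrixMap_mul, Units.inv_mul, torusMatrixMap_one]
  right_inv z := by rw [torusMatrixMap_mul, Units.mul_inv, torusMatrixMap_one]
  continuous_toFun := continuous_torusMatrixMap _
  continuous_invFun := continuous_torusMatrixMap _

/-- The matrix `diag(a, b) ∈ GL(2, ℤ)` with diagonal entries `a, b = ±1`. -/
def diagGL (a b : ℤˣ) : GL (Fin 2) ℤ where
  val := !![(a : ℤ), 0; 0, (b : ℤ)]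
  inv := !![(a : ℤ), 0; 0, (b : ℤ)]
  val_inv := by simp [Matrix.one_fin_two]
  inv_val := by simp [Matrix.one_fin_two]

/-- `(z₁, z₂) ↦ (z̄₁, z₂)`; complex conjugation is inversion on the unit circle. -/
def torusConj₁ (z : Torus) : Torus := (z.1⁻¹, z.2)

/-- `(z₁, z₂) ↦ (z₁, z̄₂)`. -/
def torusConj₂ (z : Torus) : Torus := (z.1, z.2⁻¹)

/-! ## The Klein bottle -/

/-- The relation `(z₁, z₂) ∼ (-z₁, z̄₂)` on `S¹ × S¹`. -/
inductive KleinRel : Torus → Torus → Prop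
  | rel (z : Torus) : KleinRel z (-z.1, z.2⁻¹)

/-- The Klein bottle `K = S¹ × S¹ / (z₁, z₂) ∼ (-z₁, z̄₂)`. -/
def Klein : Type := Quot KleinRel

instance : TopologicalSpace Klein := inferInstanceAs (TopologicalSpace (Quot KleinRel))

theorem neg_zpow_unit (z : Circle) (a : ℤˣ) : (-z) ^ (a : ℤ) = -(z ^ (a : ℤ)) := by
  rcases Int.units_eq_one_or a with h | h <;> subst h
  · simp
  · simp only [Units.val_neg, Units.val_one, zpow_neg, zpow_one]
    rw [inv_eq_iff_mul_eq_one]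
    simp

/-- The map `[z₁, z₂] ↦ [z₁^a, z₂^b]` of the Klein bottle, for signs `a, b = ±1`. -/
def kleinMap (a b : ℤˣ) : Klein → Klein :=
  Quot.map (fun z => (z.1 ^ (a : ℤ), z.2 ^ (b : ℤ))) (by
    rintro z _ ⟨⟩
    have h := KleinRel.rel (z.1 ^ (a : ℤ), z.2 ^ (b : ℤ))
    simpa only [neg_zpow_unit, inv_zpow] using h)

theorem kleinMap_kleinMap (a b : ℤˣ) (x : Klein) : kleinMap a b (kleinMap a b x) = x := by
  obtain ⟨z⟩ := x
  refine congrArg (Quot.mk KleinRel) (Prod.ext ?_ ?_)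
  all_goals
    simp only [← zpow_mul, ← Units.val_mul, Int.units_mul_self, Units.val_one, zpow_one]

theorem continuous_kleinMap (a b : ℤˣ) : Continuous (kleinMap a b) := by
  refine continuous_coinduced_dom.2 ?_
  have h : Continuous fun z : Torus => (z.1 ^ (a : ℤ), z.2 ^ (b : ℤ)) := by fun_prop
  exact continuous_coinduced_rng.comp h

/-- The homeomorphism `f_{a,b}` of the Klein bottle. -/
def kleinHomeo (a b : ℤˣ) : Klein ≃ₜ Klein where
  toFun := kleinMap a b
  invFun := kleinMap a b
  left_inv := kleinMap_kleinMap a b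
  right_inv := kleinMap_kleinMap a b
  continuous_toFun := continuous_kleinMap a b
  continuous_invFun := continuous_kleinMap a b

/-- `[z₁, z₂] ↦ [z̄₁, z₂]`. -/
def kleinConj₁ : Klein → Klein := kleinMap (-1) 1

/-- `[z₁, z₂] ↦ [z₁, z̄₂]`. -/
def kleinConj₂ : Klein → Klein := kleinMap 1 (-1)

end

/-! In each case the base square is a fundamental domain for the group generated by two commuting
involutions `c₁`, `c₂` of the fibre `F`, and a point of the square is fixed only by elements in the
span of the colors of the sides through it. For the torus the square is a product of two half
circles, each with both ends fixed by conjugation. For the Klein bottle the first factor is a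
quarter circle: its end `1` is fixed by conjugation, while at its end `i` conjugation is `z ↦ -z`,
so that there `[z₁, z₂]` is fixed by `c₁ c₂`. This is why the third side has color `e₁ + e₂`.

The height is rescaled to `[0, 1]`, a fundamental domain for `t ↦ -t` on `[-1, 1]`. The bottom then
lies over the fixed point `0`, with color `e₃`. The top lies over `1`, where the gluing `(x, 1) ∼ (f
x, -1)` says that `e₃` times the monodromy acts trivially. So a top of color `w` belongs to the
monodromy through which `w` acts on `F`. Hence `(x, g) ↦ g • [q x, height x]` has exactly the
relation of the small cover as its fibres (`IsFundamentalSquare.prismToTorus_eq_iff`), and a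
continuous bijection from a compact space to a Hausdorff one is a homeomorphism
(`IsFundamentalSquare.isEquivariantBundle`).

The classification of colorings is linear algebra: the side colors lie in a plane over `ℤ₂`, which
has only three nonzero vectors, and adjacent sides differ (`exists_eq_tau_rotateFacet`).

For nontriviality, a trivial mapping torus makes its monodromy homotopic to the identity
(`exists_homotopy_of_trivial`), whereas each listed monodromy reverses the degree of some loop
followed by a map to the circle (`isNontrivialBundle_of_degree_ne`). The map `f_{1,-1}` is exempt:
`[z₁, z̄₂] = [-z₁, z₂]`, and rotating `z₁` joins it to the identity. -/

noncomputable section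

/-! ## Angles on the circle -/

/-- The number `s ∈ (c, c + 2]` with `exp (π i s) = z`. -/
def circleAngle (c : ℝ) (z : Circle) : ℝ :=
  c + 1 + Complex.arg (z * Circle.exp (-(Real.pi * (c + 1))) : Circle) / Real.pi

theorem circle_exp_circleAngle (c : ℝ) (z : Circle) :
    Circle.exp (Real.pi * circleAngle c z) = z := by
  have h : Real.pi * circleAngle c z = Real.pi * (c + 1) +
      Complex.arg (z * Circle.exp (-(Real.pi * (c + 1))) : Circle) := by
    unfold circleAngle
    field_simp
  rw [h, Circle.exp_add, Circle.exp_arg, Circle.exp_neg]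
  simp

theorem circleAngle_exp {c s : ℝ} (h₁ : c < s) (h₂ : s ≤ c + 2) :
    circleAngle c (Circle.exp (Real.pi * s)) = s := by
  have h : Circle.exp (Real.pi * s) * Circle.exp (-(Real.pi * (c + 1))) =
      Circle.exp (Real.pi * (s - c - 1)) := by
    rw [← Circle.exp_add]
    congr 1
    ring
  rw [circleAngle, h, Circle.arg_exp]
  · field_simp
    ring
  · nlinarith [Real.pi_pos]
  · nlinarith [Real.pi_pos]

theorem lt_circleAngle (c : ℝ) (z : Circle) : c < circleAngle c z := by
  have h := Complex.neg_pi_lt_arg ((z * Circle.exp (-(Real.pi * (c + 1))) : Circle) : ℂ)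
  have h' : -1 < Complex.arg ((z * Circle.exp (-(Real.pi * (c + 1))) : Circle) : ℂ) / Real.pi := by
    rw [lt_div_iff₀ Real.pi_pos]
    linarith
  unfold circleAngle
  linarith

theorem circleAngle_le (c : ℝ) (z : Circle) : circleAngle c z ≤ c + 2 := by
  have h := Complex.arg_le_pi ((z * Circle.exp (-(Real.pi * (c + 1))) : Circle) : ℂ)
  have h' : Complex.arg ((z * Circle.exp (-(Real.pi * (c + 1))) : Circle) : ℂ) / Real.pi ≤ 1 := by
    rw [div_le_iff₀ Real.pi_pos]
    linarith
  unfold circleAngle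
  linarith

theorem circle_exp_pi_mul_add_two (s : ℝ) :
    Circle.exp (Real.pi * (s + 2)) = Circle.exp (Real.pi * s) := by
  rw [show Real.pi * (s + 2) = Real.pi * s + 2 * Real.pi by ring]
  exact Circle.periodic_exp _

theorem circleAngle_lt {c : ℝ} {z : Circle} (hz : z ≠ Circle.exp (Real.pi * c)) :
    circleAngle c z < c + 2 := by
  refine lt_of_le_of_ne (circleAngle_le c z) fun h => hz ?_
  rw [← circle_exp_circleAngle c z, h, circle_exp_pi_mul_add_two]

theorem circle_exp_pi_mul_one_ne : Circle.exp (Real.pi * 1) ≠ Circle.exp (Real.pi * 0) := by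
  intro h
  have h1 := circleAngle_exp (c := -1) (s := 0) (by norm_num) (by norm_num)
  have h2 := circleAngle_exp (c := -1) (s := 1) (by norm_num) (by norm_num)
  rw [← h, h2] at h1
  norm_num at h1

/-- Dividing by `exp (π i (c + 1))` moves the excluded point `exp (π i c)` to `-1`, on the branch
cut of `Complex.arg`. -/
theorem continuousOn_circleAngle (c : ℝ) :
    ContinuousOn (circleAngle c) {z | z ≠ Circle.exp (Real.pi * c)} := by
  intro z hz
  have hslit : ((z * Circle.exp (-(Real.pi * (c + 1))) : Circle) : ℂ) ∈ Complex.slitPlane := by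
    rw [Complex.mem_slitPlane_iff_arg]
    refine ⟨fun h => ?_, Circle.coe_ne_zero _⟩
    have h' : circleAngle c z = c + 2 := by
      rw [circleAngle, h, div_self Real.pi_ne_zero]
      ring
    exact (circleAngle_lt hz).ne h'
  have h := Complex.continuousAt_arg hslit
  have h2 : ContinuousAt
      (fun w : Circle => ((w * Circle.exp (-(Real.pi * (c + 1))) : Circle) : ℂ)) z := by
    fun_prop
  have h3 := ContinuousAt.comp (f := fun w : Circle =>
    ((w * Circle.exp (-(Real.pi * (c + 1))) : Circle) : ℂ)) h h2
  exact (continuousAt_const.add (h3.div_const _)).continuousWithinAt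

/-! ## The mapping torus is a locally trivial bundle -/

section MappingTorus

variable {F : Type} [TopologicalSpace F] (f : F ≃ₜ F)

theorem MappingTorus.isQuotientMap_mk : IsQuotientMap (MappingTorus.mk f) :=
  isQuotientMap_quot_mk

theorem MappingTorus.continuous_mk : Continuous (MappingTorus.mk f) :=
  continuous_quot_mk

theorem MappingTorus.mk_glue (x : F) :
    MappingTorus.mk f (x, ⟨1, by norm_num⟩) = MappingTorus.mk f (f x, ⟨-1, by norm_num⟩) :=
  Quot.sound (GlueEnds.glue x)

@[simp]
theorem MappingTorus.proj_mk (p : F × SymmInterval) :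
    MappingTorus.proj f (MappingTorus.mk f p) = Circle.exp (Real.pi * p.2.1) := rfl

theorem MappingTorus.continuous_proj : Continuous (MappingTorus.proj f) := by
  rw [(isQuotientMap_mk f).continuous_iff]
  change Continuous fun p : F × SymmInterval => Circle.exp (Real.pi * p.2.1)
  fun_prop

/-- The fibre coordinate on the part of the mapping torus over `(c, c + 2)`. -/
def MappingTorus.fibreCoord (c : ℝ) (hc : c ∈ Set.Ioc (-1 : ℝ) 1) : MappingTorus f → F :=
  -- Below height `c`, the point `[x, t]` is read as `(f⁻¹ x, t + 2)`. As `-1 < c ≤ 1`, the glued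
  -- points `(x, 1)` and `(f x, -1)` fall on different sides of `c` and both yield `x`.
  Quot.lift (fun p => if c ≤ p.2.1 then p.1 else f.symm p.1) (by
    rintro _ _ ⟨x⟩
    simp [hc.1, hc.2])

theorem MappingTorus.fibreCoord_mk (c : ℝ) (hc : c ∈ Set.Ioc (-1 : ℝ) 1) (p : F × SymmInterval) :
    MappingTorus.fibreCoord f c hc (MappingTorus.mk f p) =
      if c ≤ p.2.1 then p.1 else f.symm p.1 := rfl

/-- The class of a point of `F × [-1, 3]`, where `(x, s)` with `1 ≤ s` stands for
`(f x, s - 2)`. -/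
def MappingTorus.wrap (p : F × ℝ) : MappingTorus f :=
  -- Clamping by `Set.projIcc` only matters outside `[-1, 3]`; it makes the map total and continuous
  -- on `F × ℝ`.
  if p.2 ≤ 1 then MappingTorus.mk f (p.1, Set.projIcc (-1) 1 (by norm_num) p.2)
  else MappingTorus.mk f (f p.1, Set.projIcc (-1) 1 (by norm_num) (p.2 - 2))

theorem MappingTorus.wrap_of_le_one {x : F} {s : ℝ} (h : s ∈ Set.Icc (-1 : ℝ) 1) :
    MappingTorus.wrap f (x, s) = MappingTorus.mk f (x, ⟨s, h⟩) := by
  rw [wrap, if_pos h.2, Set.projIcc_of_mem _ h]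

theorem MappingTorus.wrap_of_one_le {x : F} {s : ℝ} (h : s - 2 ∈ Set.Icc (-1 : ℝ) 1) :
    MappingTorus.wrap f (x, s) = MappingTorus.mk f (f x, ⟨s - 2, h⟩) := by
  rw [wrap]
  split_ifs with h'
  · obtain rfl : s = 1 := le_antisymm h' (by linarith [h.1])
    rw [Set.projIcc_of_mem _ (by norm_num), mk_glue]
    congr 3
    norm_num
  · rw [Set.projIcc_of_mem _ h]

theorem MappingTorus.continuous_wrap : Continuous (MappingTorus.wrap f) := by
  unfold wrap
  refine Continuous.if_le ?_ ?_ continuous_snd continuous_const ?_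
  · exact (continuous_mk f).comp
      (continuous_fst.prodMk (continuous_projIcc.comp continuous_snd))
  · exact (continuous_mk f).comp ((f.continuous.comp continuous_fst).prodMk
      (continuous_projIcc.comp (continuous_snd.sub continuous_const)))
  · rintro ⟨x, s⟩ (rfl : s = 1)
    rw [Set.projIcc_of_mem _ (by norm_num), Set.projIcc_of_mem _ (by norm_num), mk_glue]
    congr 3
    norm_num

theorem MappingTorus.continuousOn_fibreCoord (c : ℝ) (hc : c ∈ Set.Ioc (-1 : ℝ) 1) :
    ContinuousOn (MappingTorus.fibreCoord f c hc)
      (MappingTorus.proj f ⁻¹' {z | z ≠ Circle.exp (Real.pi * c)}) := by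
  have hopen : IsOpen (proj f ⁻¹' {z | z ≠ Circle.exp (Real.pi * c)}) :=
    isOpen_ne.preimage (continuous_proj f)
  rw [(isQuotientMap_mk f).continuousOn_isOpen_iff hopen]
  rintro ⟨x, t⟩ hp
  have ht : t.1 ≠ c := fun h => hp (by simp [h])
  refine ContinuousAt.continuousWithinAt ?_
  rcases lt_or_gt_of_ne ht with h | h
  · have hev : ∀ᶠ p : F × SymmInterval in 𝓝 (x, t), p.2.1 < c :=
      (isOpen_lt (by fun_prop) continuous_const).mem_nhds h
    refine ContinuousAt.congr (f := fun p => f.symm p.1) (by fun_prop) ?_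
    filter_upwards [hev] with p hp
    rw [Function.comp_apply, fibreCoord_mk, if_neg (not_le.2 hp)]
  · have hev : ∀ᶠ p : F × SymmInterval in 𝓝 (x, t), c < p.2.1 :=
      (isOpen_lt continuous_const (by fun_prop)).mem_nhds h
    refine ContinuousAt.congr (f := fun p => p.1) (by fun_prop) ?_
    filter_upwards [hev] with p hp
    rw [Function.comp_apply, fibreCoord_mk, if_pos hp.le]

/-- The trivialization of the mapping torus over the complement of `exp (π i c)`. -/
def MappingTorus.trivialization (c : ℝ) (hc : c ∈ Set.Ioc (-1 : ℝ) 1) :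
    Bundle.Trivialization F (MappingTorus.proj f) where
  toFun y := (proj f y, fibreCoord f c hc y)
  invFun q := wrap f (q.2, circleAngle c q.1)
  source := proj f ⁻¹' {z | z ≠ Circle.exp (Real.pi * c)}
  target := {z | z ≠ Circle.exp (Real.pi * c)} ×ˢ Set.univ
  baseSet := {z | z ≠ Circle.exp (Real.pi * c)}
  map_source' y hy := ⟨hy, trivial⟩
  map_target' := by
    rintro ⟨z, x⟩ ⟨hz : z ≠ _, -⟩
    have h₁ := lt_circleAngle c z
    have h₂ := circleAngle_lt hz
    change proj f _ ≠ _
    rcases le_total (circleAngle c z) 1 with h | h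
    · rw [wrap_of_le_one f ⟨by linarith [hc.1], h⟩, proj_mk, circle_exp_circleAngle]
      exact hz
    · rw [wrap_of_one_le f ⟨by linarith, by linarith [hc.2]⟩, proj_mk, ← circle_exp_pi_mul_add_two,
        sub_add_cancel, circle_exp_circleAngle]
      exact hz
  left_inv' := by
    intro y
    obtain ⟨⟨x, t, ht⟩, rfl⟩ := (isQuotientMap_mk f).surjective y
    intro hy
    have htc : t ≠ c := fun h => hy (by simp [h])
    rw [fibreCoord_mk, proj_mk]
    rcases lt_or_gt_of_ne htc with h | h
    -- For `t < c` the representative of the angle in `(c, c + 2]` is `t + 2`; equality `t + 2 = c`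
    -- would put the point over the removed `exp (π i c)`.
    · have hlt : c < t + 2 := by
        refine lt_of_le_of_ne (by linarith [hc.2, ht.1]) fun h' => hy ?_
        change Circle.exp (Real.pi * t) = _
        rw [h', circle_exp_pi_mul_add_two]
      have hmem : t + 2 - 2 ∈ Set.Icc (-1 : ℝ) 1 := by simpa using ht
      rw [if_neg (not_le.2 h), ← circle_exp_pi_mul_add_two, circleAngle_exp hlt (by linarith),
        wrap_of_one_le f hmem]
      simp
    · rw [if_pos h.le, circleAngle_exp h (by linarith [hc.1, ht.2]), wrap_of_le_one f ht]
  right_inv' := by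
    rintro ⟨z, x⟩ ⟨hz : z ≠ _, -⟩
    have h₁ := lt_circleAngle c z
    have h₂ := circleAngle_lt hz
    rcases le_total (circleAngle c z) 1 with h | h
    · simp only
      rw [wrap_of_le_one f ⟨by linarith [hc.1], h⟩, proj_mk, circle_exp_circleAngle,
        fibreCoord_mk, if_pos h₁.le]
    · simp only
      rw [wrap_of_one_le f ⟨by linarith, by linarith [hc.2]⟩, proj_mk, ← circle_exp_pi_mul_add_two,
        sub_add_cancel, circle_exp_circleAngle, fibreCoord_mk, if_neg (not_le.2 (by linarith)),
        f.symm_apply_apply]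
  open_source := isOpen_ne.preimage (continuous_proj f)
  open_target := isOpen_ne.prod isOpen_univ
  open_baseSet := isOpen_ne
  continuousOn_toFun := (continuous_proj f).continuousOn.prodMk (continuousOn_fibreCoord f c hc)
  continuousOn_invFun := by
    refine (continuous_wrap f).comp_continuousOn (continuousOn_snd.prodMk ?_)
    exact (continuousOn_circleAngle c).comp continuousOn_fst fun q hq => hq.1
  source_eq := rfl
  target_eq := rfl
  proj_toFun _ _ := rfl

theorem MappingTorus.exists_trivialization (b : Circle) :
    ∃ e : Bundle.Trivialization F (MappingTorus.proj f), b ∈ e.baseSet := by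
  by_cases h : b = Circle.exp (Real.pi * 1)
  · refine ⟨trivialization f 0 (by norm_num), ?_⟩
    change b ≠ _
    rw [h]
    exact circle_exp_pi_mul_one_ne
  · exact ⟨trivialization f 1 (by norm_num), h⟩

/-- Points over different base points are separated in the circle, points of one fibre inside a
single trivialization. -/
instance MappingTorus.t2Space [T2Space F] : T2Space (MappingTorus f) := by
  refine ⟨fun y₁ y₂ hne => ?_⟩
  by_cases h : proj f y₁ = proj f y₂
  · obtain ⟨e, he⟩ := exists_trivialization f (proj f y₁)
    have h₁ : y₁ ∈ e.source := e.mem_source.2 he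
    have h₂ : y₂ ∈ e.source := e.mem_source.2 (h ▸ he)
    obtain ⟨u, v, hu, hv, hyu, hyv, huv⟩ := t2_separation (e.injOn.ne h₁ h₂ hne)
    refine ⟨_, _, e.isOpen_inter_preimage hu, e.isOpen_inter_preimage hv, ⟨h₁, hyu⟩, ⟨h₂, hyv⟩, ?_⟩
    exact (huv.preimage e).mono Set.inter_subset_right Set.inter_subset_right
  · obtain ⟨u, v, hu, hv, hyu, hyv, huv⟩ := t2_separation h
    exact ⟨_, _, hu.preimage (continuous_proj f), hv.preimage (continuous_proj f), hyu, hyv,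
      huv.preimage _⟩

/-- The generated equivalence relation is read off from two invariants: the projection fixes the
height up to identifying `-1` with `1`, and `fibreCoord` at `c = 1` then recovers the point of the
fibre. -/
theorem MappingTorus.eq_or_of_mk_eq {x y : F} {s t : SymmInterval}
    (h : MappingTorus.mk f (x, s) = MappingTorus.mk f (y, t)) :
    x = y ∧ s = t ∨ s.1 = 1 ∧ t.1 = -1 ∧ y = f x ∨ s.1 = -1 ∧ t.1 = 1 ∧ x = f y := by
  have hp := congrArg (proj f) h
  have hc := congrArg (fibreCoord f 1 (by norm_num)) h
  rw [proj_mk, proj_mk] at hp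
  rw [fibreCoord_mk, fibreCoord_mk] at hc
  obtain ⟨s, hs⟩ := s
  obtain ⟨t, ht⟩ := t
  simp only at hp hc ⊢
  rcases eq_or_lt_of_le hs.1 with rfl | hs'
  · rcases eq_or_lt_of_le ht.1 with rfl | ht'
    · norm_num at hc
      exact Or.inl ⟨hc, rfl⟩
    -- The height `-1` is replaced by `1`, its representative in the range `(-1, 1]` of `circleAngle
    -- (-1)`.
    · rw [← circle_exp_pi_mul_add_two] at hp
      have := congrArg (circleAngle (-1)) hp
      rw [circleAngle_exp (by norm_num) (by norm_num), circleAngle_exp ht' (by linarith [ht.2])]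
        at this
      obtain rfl : t = 1 := by linarith
      norm_num at hc
      exact Or.inr (Or.inr ⟨rfl, rfl, by simp [← hc]⟩)
  · rcases eq_or_lt_of_le ht.1 with rfl | ht'
    · rw [← circle_exp_pi_mul_add_two (-1)] at hp
      have := congrArg (circleAngle (-1)) hp
      rw [circleAngle_exp hs' (by linarith [hs.2]),
        circleAngle_exp (by norm_num) (by norm_num)] at this
      obtain rfl : s = 1 := by linarith
      norm_num at hc
      exact Or.inr (Or.inl ⟨rfl, rfl, by simp [hc]⟩)
    · have := congrArg (circleAngle (-1)) hp
      rw [circleAngle_exp hs' (by linarith [hs.2]), circleAngle_exp ht' (by linarith [ht.2])]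
        at this
      subst this
      refine Or.inl ⟨?_, rfl⟩
      split_ifs at hc
      · exact hc
      · exact f.symm.injective hc

end MappingTorus

/-! ## Small covers of the prism as mapping tori -/

section InvolutionPower

variable {X : Type}

/-- The power `c ^ a` of an involution `c`, for an exponent `a` modulo 2. -/
def involutionPow (c : X → X) (a : ZMod 2) (x : X) : X := if a = 0 then x else c x

@[simp]
theorem involutionPow_zero (c : X → X) (x : X) : involutionPow c 0 x = x := rfl

@[simp]
theorem involutionPow_one (c : X → X) (x : X) : involutionPow c 1 x = c x := rfl

theorem involutionPow_add {c : X → X} (hc : Function.Involutive c) (a b : ZMod 2) (x : X) :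
    involutionPow c (a + b) x = involutionPow c a (involutionPow c b x) := by
  fin_cases a <;> fin_cases b
  · rfl
  · rfl
  · rfl
  · exact (hc x).symm

theorem involutionPow_comm {c d : X → X} (h : ∀ x, c (d x) = d (c x)) (a b : ZMod 2) (x : X) :
    involutionPow c a (involutionPow d b x) = involutionPow d b (involutionPow c a x) := by
  fin_cases a <;> fin_cases b
  · rfl
  · rfl
  · rfl
  · exact h x

theorem continuous_involutionPow [TopologicalSpace X] {c : X → X} (hc : Continuous c)
    (a : ZMod 2) : Continuous (involutionPow c a) := by
  fin_cases a
  · exact continuous_id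
  · exact hc

/-- The action of `(ℤ₂)³` through its first two coordinates by two commuting involutions. -/
def fibreAct (c₁ c₂ : X → X) (g : Z23) (x : X) : X :=
  involutionPow c₁ (g 0) (involutionPow c₂ (g 1) x)

theorem fibreAct_congr (c₁ c₂ : X → X) {g h : Z23} (h₀ : g 0 = h 0) (h₁ : g 1 = h 1) (x : X) :
    fibreAct c₁ c₂ g x = fibreAct c₁ c₂ h x := by
  rw [fibreAct, fibreAct, h₀, h₁]

theorem fibreAct_zero (c₁ c₂ : X → X) (x : X) : fibreAct c₁ c₂ 0 x = x := rfl

theorem continuous_fibreAct [TopologicalSpace X] {c₁ c₂ : X → X} (h₁ : Continuous c₁)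
    (h₂ : Continuous c₂) (g : Z23) : Continuous (fibreAct c₁ c₂ g) :=
  (continuous_involutionPow h₁ _).comp (continuous_involutionPow h₂ _)

/-- Two commuting involutions. -/
structure IsCommutingInvolutions (c₁ c₂ : X → X) : Prop where
  involutive₁ : Function.Involutive c₁
  involutive₂ : Function.Involutive c₂
  comm : ∀ x, c₁ (c₂ x) = c₂ (c₁ x)

variable {c₁ c₂ : X → X}

theorem IsCommutingInvolutions.fibreAct_add (hc : IsCommutingInvolutions c₁ c₂) (g h : Z23)
    (x : X) : fibreAct c₁ c₂ (g + h) x = fibreAct c₁ c₂ g (fibreAct c₁ c₂ h x) := by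
  rw [fibreAct, fibreAct, fibreAct, Pi.add_apply, Pi.add_apply, involutionPow_add hc.involutive₁,
    involutionPow_add hc.involutive₂, involutionPow_comm hc.comm _ (g 1)]

theorem ZMod.eq_zero_or_one : ∀ a : ZMod 2, a = 0 ∨ a = 1 := by decide

theorem Z23.apply_eq_zero_or_one (g : Z23) (i : Fin 3) : g i = 0 ∨ g i = 1 :=
  ZMod.eq_zero_or_one _

theorem Z23.add_self (g : Z23) : g + g = 0 := CharTwo.add_self_eq_zero g

theorem IsCommutingInvolutions.fibreAct_fibreAct (hc : IsCommutingInvolutions c₁ c₂) (g : Z23)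
    (x : X) : fibreAct c₁ c₂ g (fibreAct c₁ c₂ g x) = x := by
  rw [← hc.fibreAct_add, Z23.add_self, fibreAct_zero]

end InvolutionPower

theorem involutive_reflect : Function.Involutive reflect := fun t => Subtype.ext (neg_neg t.1)

theorem continuous_reflect : Continuous reflect := by
  unfold reflect
  fun_prop

/-- The action of `(ℤ₂)³` on `F × [-1, 1]` by two involutions of `F` and the reflection. -/
def cylinderAct {F : Type} (c₁ c₂ : F → F) (g : Z23) (p : F × SymmInterval) : F × SymmInterval :=
  (fibreAct c₁ c₂ g p.1, involutionPow reflect (g 2) p.2)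

theorem cylinderAct_zero {F : Type} (c₁ c₂ : F → F) (p : F × SymmInterval) :
    cylinderAct c₁ c₂ 0 p = p := rfl

theorem IsCommutingInvolutions.cylinderAct_add {F : Type} {c₁ c₂ : F → F}
    (hc : IsCommutingInvolutions c₁ c₂) (g h : Z23) (p : F × SymmInterval) :
    cylinderAct c₁ c₂ (g + h) p = cylinderAct c₁ c₂ g (cylinderAct c₁ c₂ h p) :=
  Prod.ext (hc.fibreAct_add g h p.1) (involutionPow_add involutive_reflect _ _ _)

theorem cylinderAct_basisVec {F : Type} (c₁ c₂ : F → F) (i : Fin 3) (p : F × SymmInterval) :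
    cylinderAct c₁ c₂ (basisVec i) p = cylinderInvolution c₁ c₂ i p := by
  fin_cases i <;> rfl

theorem continuous_cylinderAct {F : Type} [TopologicalSpace F] {c₁ c₂ : F → F}
    (h₁ : Continuous c₁) (h₂ : Continuous c₂) (g : Z23) : Continuous (cylinderAct c₁ c₂ g) :=
  ((continuous_fibreAct h₁ h₂ g).comp continuous_fst).prodMk
    ((continuous_involutionPow continuous_reflect _).comp continuous_snd)

/-! ### The action induced on the mapping torus. -/

section BundleAction

variable {F : Type} [TopologicalSpace F] {c₁ c₂ : F → F}

/-- Since `f` is the action of `w`, it commutes with every `g` and is an involution. If `g` reflects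
the interval, the gluing is reversed, and `f (f x) = x` turns the reversed gluing into the original
one. -/
theorem IsCommutingInvolutions.mk_cylinderAct_glue (hc : IsCommutingInvolutions c₁ c₂)
    (f : F ≃ₜ F) (w : Z23) (hf : ∀ x, f x = fibreAct c₁ c₂ w x) (g : Z23) (x : F) :
    MappingTorus.mk f (cylinderAct c₁ c₂ g (x, ⟨1, by norm_num⟩)) =
      MappingTorus.mk f (cylinderAct c₁ c₂ g (f x, ⟨-1, by norm_num⟩)) := by
  have hcomm : fibreAct c₁ c₂ g (f x) = f (fibreAct c₁ c₂ g x) := by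
    rw [hf, hf, ← hc.fibreAct_add, ← hc.fibreAct_add, add_comm]
  rcases g.apply_eq_zero_or_one 2 with h | h
  · simp only [cylinderAct, h, involutionPow_zero, hcomm]
    exact MappingTorus.mk_glue f _
  · simp only [cylinderAct, h, involutionPow_one, hcomm]
    have h1 := (MappingTorus.mk_glue f (f (fibreAct c₁ c₂ g x))).symm
    have h2 : f (f (fibreAct c₁ c₂ g x)) = fibreAct c₁ c₂ g x := by
      rw [hf, hf (fibreAct c₁ c₂ g x), hc.fibreAct_fibreAct]
    rw [h2] at h1
    convert h1 using 3 <;> simp [reflect]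

/-- The action of `(ℤ₂)³` on the mapping torus of an element of the group generated by two
commuting involutions of the fibre. -/
@[reducible]
def IsCommutingInvolutions.bundleAction (hc : IsCommutingInvolutions c₁ c₂) (f : F ≃ₜ F) (w : Z23)
    (hf : ∀ x, f x = fibreAct c₁ c₂ w x) : AddAction Z23 (MappingTorus f) where
  vadd g := Quot.lift (fun p => MappingTorus.mk f (cylinderAct c₁ c₂ g p)) (by
    rintro _ _ ⟨x⟩
    exact hc.mk_cylinderAct_glue f w hf g x)
  zero_vadd := by
    rintro ⟨p⟩
    rfl
  add_vadd := by
    rintro g h ⟨p⟩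
    exact congrArg (MappingTorus.mk f) (hc.cylinderAct_add g h p)

end BundleAction

/-! ### Coordinates on the prism, and compactness of the small cover. -/

/-- The projection of the prism to its base square. -/
def prismBase (x : Prism4) : SymmInterval × SymmInterval := (⟨x.1 0, x.2 0⟩, ⟨x.1 1, x.2 1⟩)

/-- The height in the prism, rescaled to `[0, 1]`. -/
def prismHeight (x : Prism4) : SymmInterval :=
  ⟨(x.1 2 + 1) / 2, by linarith [(x.2 2).1], by linarith [(x.2 2).2]⟩

theorem prismHeight_nonneg (x : Prism4) : 0 ≤ (prismHeight x).1 := by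
  have := (x.2 2).1
  change 0 ≤ (x.1 2 + 1) / 2
  linarith

theorem Prism4.continuous_apply (i : Fin 3) : Continuous fun x : Prism4 => x.1 i :=
  (_root_.continuous_apply i).comp continuous_subtype_val

theorem continuous_prismBase : Continuous prismBase :=
  ((Prism4.continuous_apply 0).subtype_mk _).prodMk ((Prism4.continuous_apply 1).subtype_mk _)

theorem continuous_prismHeight : Continuous prismHeight :=
  (((Prism4.continuous_apply 2).add continuous_const).div_const 2).subtype_mk _

/-- The point of the prism with given base point and third coordinate. -/
def prismPoint (p : SymmInterval × SymmInterval) (t : SymmInterval) : Prism4 :=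
  ⟨![p.1.1, p.2.1, t.1], fun i => by
    fin_cases i
    · exact p.1.2
    · exact p.2.2
    · exact t.2⟩

theorem Prism4.ext_base_height {x y : Prism4} (h : prismBase x = prismBase y)
    (h' : prismHeight x = prismHeight y) : x = y := by
  have h0 : x.1 0 = y.1 0 := congrArg (fun p => p.1.1) h
  have h1 : x.1 1 = y.1 1 := congrArg (fun p => p.2.1) h
  have h2 : (x.1 2 + 1) / 2 = (y.1 2 + 1) / 2 := congrArg Subtype.val h'
  refine Subtype.ext (funext fun i => ?_)
  fin_cases i
  · exact h0
  · exact h1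
  · change x.1 2 = y.1 2
    linarith

instance : CompactSpace Prism4 := by
  have h : {x : Fin 3 → ℝ | ∀ i, x i ∈ Set.Icc (-1 : ℝ) 1} =
      Set.univ.pi fun _ => Set.Icc (-1 : ℝ) 1 := by
    ext x
    exact (Set.mem_univ_pi (f := x)).symm
  have hc : IsCompact {x : Fin 3 → ℝ | ∀ i, x i ∈ Set.Icc (-1 : ℝ) 1} := by
    rw [h]
    exact isCompact_univ_pi fun _ => isCompact_Icc
  exact isCompact_iff_compactSpace.1 hc

instance (lam : PrismFacet → Z23) : CompactSpace (SmallCover prismFacet lam) :=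
  inferInstanceAs (CompactSpace (Quotient (smallCoverSetoid prismFacet lam)))

/-- The data that exhibit the base square of a colored prism as a fundamental domain for two
commuting involutions of `F`, compatibly with the colors of the sides; the top has the color `w`
added to the color `e₃` of the bottom. -/
structure IsFundamentalSquare {F : Type} [TopologicalSpace F] (lam : PrismFacet → Z23)
    (c₁ c₂ : F → F) (w : Z23) (q : SymmInterval × SymmInterval → F) : Prop where
  invol : IsCommutingInvolutions c₁ c₂
  continuous₁ : Continuous c₁
  continuous₂ : Continuous c₂
  continuous_param : Continuous q
  exists_eq : ∀ z, ∃ g p, fibreAct c₁ c₂ g (q p) = z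
  eq_of_fibreAct_eq : ∀ g p p', fibreAct c₁ c₂ g (q p) = q p' → p = p'
  mem_faceGroup : ∀ (g : Z23) (x : Prism4), g 2 = 0 →
    fibreAct c₁ c₂ g (q (prismBase x)) = q (prismBase x) → g ∈ faceGroup prismFacet lam x
  side_height : ∀ k, lam (.side k) 2 = 0
  fibreAct_side : ∀ (k : Fin 4) (x : Prism4), x ∈ prismFacet (.side k) →
    fibreAct c₁ c₂ (lam (.side k)) (q (prismBase x)) = q (prismBase x)
  bottom_eq : lam .bottom = basisVec 2
  top_eq : lam .top = w
  twist_height : w 2 = 1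

/-! ### The small cover of a fundamental square as a mapping torus. -/

section Reconstruction

variable {F : Type} [TopologicalSpace F] {lam : PrismFacet → Z23}
  {c₁ c₂ : F → F} {w : Z23} {q : SymmInterval × SymmInterval → F}

/-- The map `(x, g) ↦ g • [q x, height x]` from `P × (ℤ₂)³` to the mapping torus. -/
def prismToTorus (c₁ c₂ : F → F) (q : SymmInterval × SymmInterval → F) (f : F ≃ₜ F)
    (p : Prism4 × Z23) : MappingTorus f :=
  MappingTorus.mk f (cylinderAct c₁ c₂ p.2 (q (prismBase p.1), prismHeight p.1))

theorem IsFundamentalSquare.continuous_prismToTorus (hq : IsFundamentalSquare lam c₁ c₂ w q)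
    (f : F ≃ₜ F) : Continuous (prismToTorus c₁ c₂ q f) := by
  refine continuous_prod_of_discrete_right.2 fun g => ?_
  exact (MappingTorus.continuous_mk f).comp ((continuous_cylinderAct hq.continuous₁
    hq.continuous₂ g).comp ((hq.continuous_param.comp continuous_prismBase).prodMk
      continuous_prismHeight))

theorem IsFundamentalSquare.vadd_prismToTorus (hq : IsFundamentalSquare lam c₁ c₂ w q)
    (f : F ≃ₜ F) (hf : ∀ x, f x = fibreAct c₁ c₂ w x) (x : Prism4) (g h : Z23) :
    (hq.invol.bundleAction f w hf).vadd g (prismToTorus c₁ c₂ q f (x, h)) =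
      prismToTorus c₁ c₂ q f (x, g + h) :=
  (congrArg (MappingTorus.mk f) (hq.invol.cylinderAct_add g h _)).symm

/-- On a side, the color fixes the base point by assumption. On the bottom the height is `0`, which
the reflection fixes. On the top, `w` sends `(z, 1)` to `(f z, -1)`, which is glued to `(z, 1)`. -/
theorem IsFundamentalSquare.prismToTorus_facet (hq : IsFundamentalSquare lam c₁ c₂ w q)
    (f : F ≃ₜ F) (hf : ∀ x, f x = fibreAct c₁ c₂ w x) (i : PrismFacet) (x : Prism4)
    (hx : x ∈ prismFacet i) :
    prismToTorus c₁ c₂ q f (x, lam i) = prismToTorus c₁ c₂ q f (x, 0) := by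
  unfold prismToTorus
  simp only [cylinderAct_zero]
  cases i with
  | side k => simp [cylinderAct, hq.side_height, hq.fibreAct_side k x hx]
  | bottom =>
    have hx' : x.1 2 = -1 := hx
    rw [hq.bottom_eq, cylinderAct_basisVec]
    refine congrArg (MappingTorus.mk f) (Prod.ext rfl (Subtype.ext ?_))
    simp [cylinderInvolution, reflect, prismHeight, hx']
  | top =>
    have hx' : x.1 2 = 1 := hx
    have h1 : prismHeight x = ⟨1, by norm_num⟩ := by
      refine Subtype.ext ?_
      simp [prismHeight, hx']
    rw [hq.top_eq, cylinderAct, hq.twist_height, ← hf, h1, MappingTorus.mk_glue]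
    rfl

theorem IsFundamentalSquare.prismToTorus_eq_of_mem (hq : IsFundamentalSquare lam c₁ c₂ w q)
    (f : F ≃ₜ F) (hf : ∀ x, f x = fibreAct c₁ c₂ w x) (x : Prism4) (d : Z23)
    (hd : d ∈ faceGroup prismFacet lam x) (g : Z23) :
    prismToTorus c₁ c₂ q f (x, g + d) = prismToTorus c₁ c₂ q f (x, g) := by
  induction hd using Submodule.span_induction generalizing g with
  | mem d hd =>
    obtain ⟨i, hi, rfl⟩ := hd
    rw [← hq.vadd_prismToTorus f hf, hq.prismToTorus_facet f hf i x hi,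
      hq.vadd_prismToTorus f hf, add_zero]
  | zero => rw [add_zero]
  | add d e _ _ hd he => rw [← add_assoc, he, hd]
  | smul a d _ hd =>
    obtain rfl | rfl : a = 0 ∨ a = 1 := ZMod.eq_zero_or_one a
    · rw [zero_smul, add_zero]
    · rw [one_smul, hd]

/-- The case of two points identified by the gluing. Heights are nonnegative, so signed heights `1`
and `-1` force both points onto the top, with `g 2 = 0` and `h 2 = 1`. -/
theorem IsFundamentalSquare.mem_faceGroup_of_mem_top (hq : IsFundamentalSquare lam c₁ c₂ w q)
    (f : F ≃ₜ F) (hf : ∀ x, f x = fibreAct c₁ c₂ w x) {x y : Prism4} {g h : Z23}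
    (hx : (involutionPow reflect (g 2) (prismHeight x)).1 = 1)
    (hy : (involutionPow reflect (h 2) (prismHeight y)).1 = -1)
    (hxy : fibreAct c₁ c₂ h (q (prismBase y)) = f (fibreAct c₁ c₂ g (q (prismBase x)))) :
    x = y ∧ g - h ∈ faceGroup prismFacet lam x := by
  have hx0 := prismHeight_nonneg x
  have hy0 := prismHeight_nonneg y
  rcases g.apply_eq_zero_or_one 2 with hg | hg
  swap
  · rw [hg] at hx
    change -(prismHeight x).1 = 1 at hx
    linarith
  rcases h.apply_eq_zero_or_one 2 with hh | hh
  · rw [hh] at hy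
    change (prismHeight y).1 = -1 at hy
    linarith
  rw [hg] at hx
  rw [hh] at hy
  change (prismHeight x).1 = 1 at hx
  change -(prismHeight y).1 = -1 at hy
  -- All elements act on `F` by involutions, so `hxy` says that `h + w + g` carries one base point
  -- to the other. Its last coordinate is `1 + 1 + 0 = 0`, and it differs from `g - h` only by the
  -- top color `w`.
  have hd : fibreAct c₁ c₂ (h + (w + g)) (q (prismBase x)) = q (prismBase y) := by
    rw [hq.invol.fibreAct_add, hq.invol.fibreAct_add, ← hf, ← hxy, hq.invol.fibreAct_fibreAct]
  have hbase := hq.eq_of_fibreAct_eq _ _ _ hd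
  have hxy' : x = y := Prism4.ext_base_height hbase (Subtype.ext (by linarith))
  refine ⟨hxy', ?_⟩
  rw [← hbase] at hd
  have hmem := hq.mem_faceGroup _ x (by
    rw [Pi.add_apply, Pi.add_apply, hg, hh, hq.twist_height]
    decide) hd
  have htop : x ∈ prismFacet .top := by
    change (x.1 2 + 1) / 2 = 1 at hx
    change x.1 2 = 1
    linarith
  have hw : w ∈ faceGroup prismFacet lam x :=
    Submodule.subset_span ⟨.top, htop, hq.top_eq⟩
  have := (faceGroup prismFacet lam x).add_mem hmem hw
  have he : h + (w + g) + w = g - h := by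
    rw [CharTwo.sub_eq_add, show h + (w + g) + w = g + h + (w + w) by abel, Z23.add_self, add_zero]
  rwa [he] at this

theorem IsFundamentalSquare.prismToTorus_eq_iff (hq : IsFundamentalSquare lam c₁ c₂ w q)
    (f : F ≃ₜ F) (hf : ∀ x, f x = fibreAct c₁ c₂ w x) (x y : Prism4) (g h : Z23) :
    prismToTorus c₁ c₂ q f (x, g) = prismToTorus c₁ c₂ q f (y, h) ↔
      x = y ∧ g - h ∈ faceGroup prismFacet lam x := by
  constructor
  · intro heq
    rcases MappingTorus.eq_or_of_mk_eq f heq with ⟨h1, h2⟩ | ⟨h1, h2, h3⟩ | ⟨h1, h2, h3⟩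
    · simp only at h1 h2
      have hd : fibreAct c₁ c₂ (h + g) (q (prismBase x)) = q (prismBase y) := by
        rw [hq.invol.fibreAct_add, h1, hq.invol.fibreAct_fibreAct]
      have hbase := hq.eq_of_fibreAct_eq _ _ _ hd
      rw [← hbase] at hd
      have hx0 := prismHeight_nonneg x
      have hy0 := prismHeight_nonneg y
      have h2' := congrArg Subtype.val h2
      have hs : g - h = h + g := by rw [CharTwo.sub_eq_add, add_comm]
      rw [hs]
      have hsame : g 2 = h 2 → (h + g) 2 = 0 := fun e => by
        rw [Pi.add_apply, e]
        exact CharTwo.add_self_eq_zero _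
      -- Opposite signs of nonnegative heights leave only height `0`. There the bottom color `e₃`
      -- lies in the face group and corrects the last coordinate of `h + g`.
      have hdiff : (prismHeight x).1 = -(prismHeight y).1 → (h + g) 2 = 1 →
          x = y ∧ h + g ∈ faceGroup prismFacet lam x := by
        intro e e'
        have hx : (prismHeight x).1 = 0 := by linarith
        refine ⟨Prism4.ext_base_height hbase (Subtype.ext (by linarith)), ?_⟩
        have hbot : x ∈ prismFacet .bottom := by
          change (x.1 2 + 1) / 2 = 0 at hx
          change x.1 2 = -1
          linarith
        have hb : basisVec 2 ∈ faceGroup prismFacet lam x :=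
          Submodule.subset_span ⟨.bottom, hbot, hq.bottom_eq⟩
        have hmem := hq.mem_faceGroup (h + g + basisVec 2) x (by
          rw [Pi.add_apply, e']
          decide) (by
          rw [fibreAct_congr c₁ c₂ (h := h + g) (add_zero ((h + g) 0)) (add_zero ((h + g) 1)), hd,
            hbase])
        have := (faceGroup prismFacet lam x).add_mem hmem hb
        rwa [add_assoc, Z23.add_self, add_zero] at this
      rcases g.apply_eq_zero_or_one 2 with hg | hg <;>
        rcases h.apply_eq_zero_or_one 2 with hh | hh <;> rw [hg, hh] at h2'
      · exact ⟨Prism4.ext_base_height hbase (Subtype.ext h2'),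
          hq.mem_faceGroup _ x (hsame (hg.trans hh.symm)) hd⟩
      · exact hdiff h2' (by rw [Pi.add_apply, hg, hh, add_zero])
      · exact hdiff (neg_eq_iff_eq_neg.1 h2') (by rw [Pi.add_apply, hg, hh, zero_add])
      · exact ⟨Prism4.ext_base_height hbase (Subtype.ext (neg_injective h2')),
          hq.mem_faceGroup _ x (hsame (hg.trans hh.symm)) hd⟩
    · exact hq.mem_faceGroup_of_mem_top f hf h1 h2 h3
    · obtain ⟨e, hmem⟩ := hq.mem_faceGroup_of_mem_top f hf h2 h1 h3
      subst e
      refine ⟨rfl, ?_⟩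
      rw [← neg_sub]
      exact neg_mem hmem
  · rintro ⟨rfl, hd⟩
    have := hq.prismToTorus_eq_of_mem f hf x _ hd h
    rwa [add_sub_cancel] at this

theorem IsFundamentalSquare.surjective_prismToTorus (hq : IsFundamentalSquare lam c₁ c₂ w q)
    (f : F ≃ₜ F) : Function.Surjective (prismToTorus c₁ c₂ q f) := by
  rintro ⟨z, t⟩
  obtain ⟨g, p, rfl⟩ := hq.exists_eq z
  have habs : |t.1| ≤ 1 := abs_le.2 t.2
  -- The rescaled height has to be `|t|`, and the last coordinate of the group element records the
  -- sign of `t`.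
  refine ⟨(prismPoint p ⟨2 * |t.1| - 1, by linarith [abs_nonneg t.1], by linarith⟩,
    ![g 0, g 1, if 0 ≤ t.1 then 0 else 1]), congrArg (MappingTorus.mk f) (Prod.ext rfl ?_)⟩
  refine Subtype.ext ?_
  simp only [cylinderAct]
  rcases le_or_gt 0 t.1 with h | h
  · simp [h, prismHeight, prismPoint, abs_of_nonneg]
  · simp [not_le.2 h, prismHeight, prismPoint, reflect, abs_of_neg h]
    ring

/-- A prism whose base square is a fundamental domain for two commuting involutions of `F` has the
mapping torus of an element of the group they generate as its small cover. -/
theorem IsFundamentalSquare.isEquivariantBundle [T2Space F]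
    (hq : IsFundamentalSquare lam c₁ c₂ w q) (f : F ≃ₜ F)
    (hf : ∀ x, f x = fibreAct c₁ c₂ w x) : IsEquivariantBundle lam c₁ c₂ f := by
  refine ⟨MappingTorus.exists_trivialization f, hq.invol.bundleAction f w hf, fun i p =>
    congrArg (MappingTorus.mk f) (cylinderAct_basisVec c₁ c₂ i p), ?_⟩
  let φ : SmallCover prismFacet lam → MappingTorus f :=
    Quotient.lift (prismToTorus c₁ c₂ q f)
      fun p p' h => (hq.prismToTorus_eq_iff f hf p.1 p'.1 p.2 p'.2).2 h
  have hφ : Function.Bijective φ := by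
    constructor
    · rintro ⟨p⟩ ⟨p'⟩ h
      exact Quotient.sound ((hq.prismToTorus_eq_iff f hf p.1 p'.1 p.2 p'.2).1 h)
    · intro y
      obtain ⟨p, rfl⟩ := hq.surjective_prismToTorus f y
      exact ⟨Quotient.mk _ p, rfl⟩
  have hcont : Continuous (Equiv.ofBijective φ hφ) :=
    (hq.continuous_prismToTorus f).quotient_lift _
  refine ⟨hcont.homeoOfEquivCompactToT2, ?_⟩
  rintro g ⟨x, h⟩
  exact (hq.vadd_prismToTorus f hf x g h).symm

end Reconstruction

/-! ## Colorings of the prism -/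

/-- The three facets at a vertex of the prism. -/
def vertexFacets (a b c : Bool) : Fin 3 → PrismFacet :=
  ![.side (if a then 0 else 2), .side (if b then 1 else 3), if c then .top else .bottom]

theorem vertexFacets_injective (a b c : Bool) : Function.Injective (vertexFacets a b c) := by
  intro i j
  cases a <;> cases b <;> cases c <;> fin_cases i <;> fin_cases j <;> simp [vertexFacets]

theorem exists_mem_vertexFacets (a b c : Bool) :
    ∃ x : Prism4, ∀ i, x ∈ prismFacet (vertexFacets a b c i) := by
  refine ⟨⟨![if a then 1 else -1, if b then 1 else -1, if c then 1 else -1], fun i => ?_⟩,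
    fun i => ?_⟩
  · fin_cases i <;> cases a <;> cases b <;> cases c <;> norm_num
  · fin_cases i <;> cases a <;> cases b <;> cases c <;> rfl

/-- In each coordinate direction a point lies on at most one of the two opposite facets; if it lies
on neither, the choice is immaterial and falls on the negative one. -/
theorem exists_subset_vertexFacets (x : Prism4) :
    ∃ a b c, ∀ i, x ∈ prismFacet i → i ∈ Set.range (vertexFacets a b c) := by
  classical
  refine ⟨decide (x.1 0 = 1), decide (x.1 1 = 1), decide (x.1 2 = 1), fun i hi => ?_⟩
  cases i with
  | side k =>
    fin_cases k
    · exact ⟨0, by simp [vertexFacets, show x.1 0 = 1 from hi]⟩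
    · exact ⟨1, by simp [vertexFacets, show x.1 1 = 1 from hi]⟩
    · refine ⟨0, ?_⟩
      have h : x.1 0 = -1 := hi
      norm_num [vertexFacets, h]
      rfl
    · refine ⟨1, ?_⟩
      have h : x.1 1 = -1 := hi
      norm_num [vertexFacets, h]
      rfl
  | bottom =>
    refine ⟨2, ?_⟩
    have h : x.1 2 = -1 := hi
    norm_num [vertexFacets, h]
    rfl
  | top => exact ⟨2, by simp [vertexFacets, show x.1 2 = 1 from hi]⟩

/-- Subfamilies of independent families are independent, so the condition at all points reduces to
the eight vertices. -/
theorem isColoring_prism_iff (lam : PrismFacet → Z23) : IsColoring prismFacet lam ↔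
    ∀ a b c, LinearIndependent (ZMod 2) (fun i => lam (vertexFacets a b c i)) := by
  constructor
  · intro h a b c
    obtain ⟨x, hx⟩ := exists_mem_vertexFacets a b c
    exact (h x).comp (fun i => ⟨vertexFacets a b c i, hx i⟩) fun i j hij =>
      vertexFacets_injective a b c (congrArg Subtype.val hij)
  · intro h x
    obtain ⟨a, b, c, hx⟩ := exists_subset_vertexFacets x
    choose g hg using hx
    have heq : (fun i : {i : PrismFacet // x ∈ prismFacet i} => lam i) =
        (fun i => lam (vertexFacets a b c i)) ∘ fun i => g i.1 i.2 := by
      funext i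
      exact congrArg lam (hg i.1 i.2).symm
    rw [heq]
    refine (h a b c).comp _ fun i j hij => Subtype.ext ?_
    rw [← hg i.1 i.2, ← hg j.1 j.2]
    exact congrArg _ hij

theorem isTwoIndependent_of_neighbors {lam : PrismFacet → Z23} {i : PrismFacet}
    (h : {j | j ≠ i ∧ (prismFacet i ∩ prismFacet j).Nonempty} = Set.range PrismFacet.side) :
    IsTwoIndependent prismFacet lam i ↔
      Module.finrank (ZMod 2) (Submodule.span (ZMod 2) (Set.range fun k => lam (.side k))) = 2 := by
  rw [IsTwoIndependent, h, ← Set.range_comp]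
  rfl

theorem neighbors_top : {j | j ≠ .top ∧ (prismFacet .top ∩ prismFacet j).Nonempty} =
    Set.range PrismFacet.side := by
  ext j
  constructor
  · rintro ⟨hj, x, hx, hx'⟩
    cases j with
    | side k => exact ⟨k, rfl⟩
    | bottom =>
      have h1 : x.1 2 = 1 := hx
      have h2 : x.1 2 = -1 := hx'
      norm_num [h1] at h2
    | top => exact absurd rfl hj
  · rintro ⟨k, rfl⟩
    refine ⟨by simp, ?_⟩
    fin_cases k
    · obtain ⟨x, hx⟩ := exists_mem_vertexFacets true true true
      exact ⟨x, hx 2, hx 0⟩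
    · obtain ⟨x, hx⟩ := exists_mem_vertexFacets true true true
      exact ⟨x, hx 2, hx 1⟩
    · obtain ⟨x, hx⟩ := exists_mem_vertexFacets false false true
      exact ⟨x, hx 2, hx 0⟩
    · obtain ⟨x, hx⟩ := exists_mem_vertexFacets false false true
      exact ⟨x, hx 2, hx 1⟩

theorem neighbors_bottom : {j | j ≠ .bottom ∧ (prismFacet .bottom ∩ prismFacet j).Nonempty} =
    Set.range PrismFacet.side := by
  ext j
  constructor
  · rintro ⟨hj, x, hx, hx'⟩
    cases j with
    | side k => exact ⟨k, rfl⟩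
    | bottom => exact absurd rfl hj
    | top =>
      have h1 : x.1 2 = -1 := hx
      have h2 : x.1 2 = 1 := hx'
      norm_num [h1] at h2
  · rintro ⟨k, rfl⟩
    refine ⟨by simp, ?_⟩
    fin_cases k
    · obtain ⟨x, hx⟩ := exists_mem_vertexFacets true true false
      exact ⟨x, hx 2, hx 0⟩
    · obtain ⟨x, hx⟩ := exists_mem_vertexFacets true true false
      exact ⟨x, hx 2, hx 1⟩
    · obtain ⟨x, hx⟩ := exists_mem_vertexFacets false false false
      exact ⟨x, hx 2, hx 0⟩
    · obtain ⟨x, hx⟩ := exists_mem_vertexFacets false false false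
      exact ⟨x, hx 2, hx 1⟩

theorem isTwistColoring_iff (lam : PrismFacet → Z23) : IsTwistColoring lam ↔
    (∀ a b c, LinearIndependent (ZMod 2) (fun i => lam (vertexFacets a b c i))) ∧
    Module.finrank (ZMod 2) (Submodule.span (ZMod 2) (Set.range fun k => lam (.side k))) = 2 ∧
    lam .top ≠ lam .bottom := by
  rw [IsTwistColoring, isColoring_prism_iff, isTwoIndependent_of_neighbors neighbors_top,
    isTwoIndependent_of_neighbors neighbors_bottom]
  tauto

/-- The span of the side colors has dimension 2 if and only if it is spanned by the first two. -/
theorem finrank_span_sides_eq_two_iff {s : Fin 4 → Z23}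
    (h : LinearIndependent (ZMod 2) ![s 0, s 1]) :
    Module.finrank (ZMod 2) (Submodule.span (ZMod 2) (Set.range s)) = 2 ↔
      ∀ k, s k ∈ Submodule.span (ZMod 2) {s 0, s 1} := by
  have h2 : Module.finrank (ZMod 2) (Submodule.span (ZMod 2) {s 0, s 1}) = 2 := by
    have := finrank_span_eq_card h
    rwa [Matrix.range_cons_cons_empty, Fintype.card_fin] at this
  have hle : Submodule.span (ZMod 2) {s 0, s 1} ≤ Submodule.span (ZMod 2) (Set.range s) := by
    refine Submodule.span_mono ?_
    rintro _ (rfl | rfl) <;> exact Set.mem_range_self _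
  constructor
  · intro hr k
    rw [Submodule.eq_of_le_of_finrank_eq hle (h2.trans hr.symm)]
    exact Submodule.subset_span (Set.mem_range_self k)
  · intro hk
    have hge : Submodule.span (ZMod 2) (Set.range s) ≤ Submodule.span (ZMod 2) {s 0, s 1} := by
      refine Submodule.span_le.2 ?_
      rintro _ ⟨k, rfl⟩
      exact hk k
    rw [le_antisymm hge hle, h2]

theorem linearIndependent_sides {lam : PrismFacet → Z23}
    (h : ∀ a b c, LinearIndependent (ZMod 2) (fun i => lam (vertexFacets a b c i))) :
    LinearIndependent (ZMod 2) ![lam (.side 0), lam (.side 1)] := by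
  have h' := (h true true true).comp ![0, 1] (by decide)
  convert h' using 1
  funext i
  fin_cases i <;> rfl

theorem linearIndependent_tau : ∀ (j : Fin 6) (a b c : Bool) (g : Fin 3 → ZMod 2),
    ∑ i, g i • tau j (vertexFacets a b c i) = 0 → ∀ i, g i = 0 := by
  decide +kernel

theorem tau_side_mem : ∀ (j : Fin 6) (k : Fin 4),
    ∃ a b : ZMod 2, a • tau j (.side 0) + b • tau j (.side 1) = tau j (.side k) := by
  decide +kernel

theorem tau_top_ne_bottom : ∀ j : Fin 6, tau j .top ≠ tau j .bottom := by
  decide +kernel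

theorem isTwistColoring_tau (j : Fin 6) : IsTwistColoring (tau j) := by
  have hli : ∀ a b c, LinearIndependent (ZMod 2) (fun i => tau j (vertexFacets a b c i)) :=
    fun a b c => Fintype.linearIndependent_iff.2 (linearIndependent_tau j a b c)
  refine (isTwistColoring_iff _).2 ⟨hli, ?_, tau_top_ne_bottom j⟩
  rw [finrank_span_sides_eq_two_iff (s := fun k => tau j (.side k)) (linearIndependent_sides hli)]
  exact fun k => Submodule.mem_span_pair.2 (tau_side_mem j k)

theorem exists_linearEquiv_basisVec {v : Fin 3 → Z23} (h : LinearIndependent (ZMod 2) v) :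
    ∃ σ : Z23 ≃ₗ[ZMod 2] Z23, ∀ i, σ (basisVec i) = v i := by
  let b := basisOfLinearIndependentOfCardEqFinrank h (by simp)
  refine ⟨(Pi.basisFun (ZMod 2) (Fin 3)).equiv b (Equiv.refl _), fun i => ?_⟩
  have h1 : basisVec i = Pi.basisFun (ZMod 2) (Fin 3) i := by
    rw [Pi.basisFun_apply]
    rfl
  rw [h1, Module.Basis.equiv_apply]
  simp [b]

theorem Z23.eq_sum_basisVec (g : Z23) :
    g = g 0 • basisVec 0 + g 1 • basisVec 1 + g 2 • basisVec 2 := by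
  revert g
  decide +kernel

/-- The colorings in a linear coordinate system of the colors in which they become `tau j`. -/
theorem exists_eq_tau {s : PrismFacet → Z23} (σ : Z23 ≃ₗ[ZMod 2] Z23)
    (h0 : σ (basisVec 0) = s (.side 0)) (h1 : σ (basisVec 1) = s (.side 1))
    (hb : σ (basisVec 2) = s .bottom)
    (h2 : s (.side 2) = s (.side 0) ∨ s (.side 2) = s (.side 0) + s (.side 1))
    (h3 : s (.side 3) = s (.side 1))
    (ht : s .top = s .bottom + s (.side 0) ∨ s .top = s .bottom + s (.side 1) ∨
      s .top = s .bottom + s (.side 0) + s (.side 1)) :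
    ∃ j, ∀ F, s F = σ (tau j F) := by
  -- The six colorings differ only on side 2 and on the top.
  have key : ∀ j, s (.side 2) = σ (tau j (.side 2)) → s .top = σ (tau j .top) →
      ∀ F, s F = σ (tau j F) := by
    intro j h2' ht' F
    cases F with
    | bottom =>
      rw [← hb]
      fin_cases j <;> rfl
    | top => exact ht'
    | side k =>
      fin_cases k
      · refine h0.symm.trans ?_
        fin_cases j <;> rfl
      · refine h1.symm.trans ?_
        fin_cases j <;> rfl
      · exact h2'
      · refine (h3.trans h1.symm).trans ?_
        fin_cases j <;> rfl
  rcases h2 with h2 | h2 <;> rcases ht with ht | ht | ht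
  · exact ⟨0, key 0 (h2.trans h0.symm) (by rw [ht, ← h0, ← hb, ← map_add]; rfl)⟩
  · exact ⟨1, key 1 (h2.trans h0.symm) (by rw [ht, ← h1, ← hb, ← map_add]; rfl)⟩
  · exact ⟨2, key 2 (h2.trans h0.symm) (by rw [ht, ← h0, ← h1, ← hb, ← map_add, ← map_add]; rfl)⟩
  · exact ⟨3, key 3 (by rw [h2, ← h0, ← h1, ← map_add]; rfl)
      (by rw [ht, ← h0, ← hb, ← map_add]; rfl)⟩
  · exact ⟨4, key 4 (by rw [h2, ← h0, ← h1, ← map_add]; rfl)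
      (by rw [ht, ← h1, ← hb, ← map_add]; rfl)⟩
  · exact ⟨5, key 5 (by rw [h2, ← h0, ← h1, ← map_add]; rfl)
      (by rw [ht, ← h0, ← h1, ← hb, ← map_add, ← map_add]; rfl)⟩

/-- Write `s₀, …, s₃` for the side colors. In the plane spanned by `s₀`, `s₁`, independence at the
vertices leaves `s₂ ∈ {s₀, s₀ + s₁}` and `s₃ ∈ {s₁, s₀ + s₁}`, and adjacency forbids that both equal
`s₀ + s₁`. If `s₃ = s₁` no rotation is needed; otherwise a quarter turn moves the exceptional side
to position 2. -/
theorem exists_eq_tau_rotateFacet {lam : PrismFacet → Z23} (h : IsTwistColoring lam) :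
    ∃ (σ : Z23 ≃ₗ[ZMod 2] Z23) (r : Fin 4) (j : Fin 6),
      ∀ F : PrismFacet, lam F = σ (tau j (rotateFacet r F)) := by
  obtain ⟨hli, hrank, htb⟩ := (isTwistColoring_iff lam).1 h
  rw [finrank_span_sides_eq_two_iff (s := fun k => lam (.side k)) (linearIndependent_sides hli)]
    at hrank
  have hne : ∀ a b c i j, i ≠ j → lam (vertexFacets a b c i) ≠ lam (vertexFacets a b c j) :=
    fun a b c i j hij e => hij ((hli a b c).injective e)
  have h2ne0 : lam (.side 2) ≠ 0 := (hli false true true).ne_zero 0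
  have h3ne0 : lam (.side 3) ≠ 0 := (hli true false true).ne_zero 1
  have h21 : lam (.side 2) ≠ lam (.side 1) := hne false true true 0 1 (by decide)
  have h23 : lam (.side 2) ≠ lam (.side 3) := hne false false true 0 1 (by decide)
  have h30 : lam (.side 0) ≠ lam (.side 3) := hne true false true 0 1 (by decide)
  have h2 : lam (.side 2) = lam (.side 0) ∨ lam (.side 2) = lam (.side 0) + lam (.side 1) := by
    obtain ⟨a, b, e⟩ := Submodule.mem_span_pair.1 (hrank 2)
    rcases ZMod.eq_zero_or_one a with rfl | rfl <;>
      rcases ZMod.eq_zero_or_one b with rfl | rfl <;> simp_all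
  have h3 : lam (.side 3) = lam (.side 1) ∨ lam (.side 3) = lam (.side 1) + lam (.side 0) := by
    obtain ⟨a, b, e⟩ := Submodule.mem_span_pair.1 (hrank 3)
    rcases ZMod.eq_zero_or_one a with rfl | rfl <;>
      rcases ZMod.eq_zero_or_one b with rfl | rfl <;> simp_all [add_comm]
  obtain ⟨σ, hσ⟩ := exists_linearEquiv_basisVec (hli true true false)
  have hs0 : σ (basisVec 0) = lam (.side 0) := hσ 0
  have hs1 : σ (basisVec 1) = lam (.side 1) := hσ 1
  have hb : σ (basisVec 2) = lam .bottom := hσ 2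
  have ht : lam .top = lam .bottom + lam (.side 0) ∨ lam .top = lam .bottom + lam (.side 1) ∨
      lam .top = lam .bottom + lam (.side 0) + lam (.side 1) := by
    have e : lam .top = (σ.symm (lam .top)) 0 • lam (.side 0) +
        (σ.symm (lam .top)) 1 • lam (.side 1) + (σ.symm (lam .top)) 2 • lam .bottom := by
      rw [← hs0, ← hs1, ← hb, ← map_smul, ← map_smul, ← map_smul, ← map_add, ← map_add,
        ← Z23.eq_sum_basisVec, σ.apply_symm_apply]
    generalize (σ.symm (lam .top)) 0 = a, (σ.symm (lam .top)) 1 = b,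
      (σ.symm (lam .top)) 2 = c at e
    rcases ZMod.eq_zero_or_one c with rfl | rfl
    -- Without a bottom component the top color would lie in the span of two sides that it meets at
    -- a vertex.
    · have := Fintype.linearIndependent_iff.1 (hli true true true) ![a, b, 1] (by
        change ∑ i, ![a, b, 1] i • ![lam (.side 0), lam (.side 1), lam .top] i = 0
        rw [Fin.sum_univ_three]
        change a • lam (.side 0) + b • lam (.side 1) + (1 : ZMod 2) • lam .top = 0
        rw [e, zero_smul, add_zero, one_smul, Z23.add_self]) 2
      exact absurd this (one_ne_zero (α := ZMod 2))
    · rcases ZMod.eq_zero_or_one a with rfl | rfl <;>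
        rcases ZMod.eq_zero_or_one b with rfl | rfl
      · exact absurd (by simpa using e) htb
      · exact Or.inr (Or.inl (by simpa [add_comm] using e))
      · exact Or.inl (by simpa [add_comm] using e)
      · refine Or.inr (Or.inr ?_)
        rw [e, one_smul, one_smul, one_smul]
        abel
  rcases h3 with h3 | h3
  · obtain ⟨j, hj⟩ := exists_eq_tau σ hs0 hs1 hb h2 h3 ht
    refine ⟨σ, 0, j, fun F => ?_⟩
    rw [hj F]
    cases F <;> simp [rotateFacet]
  · have h2' : lam (.side 2) = lam (.side 0) := h2.resolve_right fun e =>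
      h23 (by rw [e, h3, add_comm])
    -- Starting from side 1 the colors read `s₁, s₀, s₁ + s₀, s₀`, so the new basis swaps the first
    -- two vectors. The rotation is by `3`, the inverse of the shift `k ↦ k + 1`.
    obtain ⟨τ, hτ⟩ := exists_linearEquiv_basisVec
      ((hli true true false).comp ![1, 0, 2] (by decide))
    have hs := exists_eq_tau
      (s := mkColoring (fun k => lam (.side (k + 1))) (lam .bottom) (lam .top)) τ
      (hτ 0) ((hτ 1).trans h2'.symm) (hτ 2)
      (Or.inr (by rw [← h2'] at h3; exact h3)) h2'.symm (by
        change lam .top = lam .bottom + lam (.side 1) ∨ lam .top = lam .bottom + lam (.side 2) ∨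
          lam .top = lam .bottom + lam (.side 1) + lam (.side 2)
        rw [h2']
        rcases ht with ht | ht | ht
        · exact Or.inr (Or.inl ht)
        · exact Or.inl ht
        · exact Or.inr (Or.inr (by rw [ht]; abel)))
    obtain ⟨j, hj⟩ := hs
    refine ⟨τ, 3, j, fun F => ?_⟩
    rw [← hj]
    cases F with
    | side k => fin_cases k <;> rfl
    | bottom => rfl
    | top => rfl

/-! ## Fundamental squares of the torus and the Klein bottle -/

theorem circle_ext_re_im {z w : Circle} (h : (z : ℂ).re = (w : ℂ).re)
    (h' : (z : ℂ).im = (w : ℂ).im) : z = w :=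
  Circle.ext (Complex.ext h h')

theorem circle_re_inv (z : Circle) : ((z⁻¹ : Circle) : ℂ).re = (z : ℂ).re := by
  rw [Circle.coe_inv_eq_conj, Complex.conj_re]

theorem circle_im_inv (z : Circle) : ((z⁻¹ : Circle) : ℂ).im = -(z : ℂ).im := by
  rw [Circle.coe_inv_eq_conj, Complex.conj_im]

theorem circle_re_neg (z : Circle) : ((-z : Circle) : ℂ).re = -(z : ℂ).re := by
  rw [Circle.coe_neg, Complex.neg_re]

theorem circle_im_neg (z : Circle) : ((-z : Circle) : ℂ).im = -(z : ℂ).im := by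
  rw [Circle.coe_neg, Complex.neg_im]

theorem circle_sq_add_sq (z : Circle) : (z : ℂ).re ^ 2 + (z : ℂ).im ^ 2 = 1 := by
  have := Circle.normSq_coe z
  rw [Complex.normSq_apply] at this
  linarith

theorem circle_re_mem (z : Circle) : (z : ℂ).re ∈ Set.Icc (-1 : ℝ) 1 := by
  have := circle_sq_add_sq z
  constructor <;> nlinarith [sq_nonneg (z : ℂ).im]

theorem circle_inv_eq_self_iff (z : Circle) : z⁻¹ = z ↔ (z : ℂ).im = 0 := by
  constructor
  · intro h
    have := circle_im_inv z
    rw [h] at this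
    linarith
  · intro h
    exact circle_ext_re_im (circle_re_inv z) (by rw [circle_im_inv, h, neg_zero])

theorem circle_inv_eq_neg_iff (z : Circle) : z⁻¹ = -z ↔ (z : ℂ).re = 0 := by
  constructor
  · intro h
    have := circle_re_inv z
    rw [h, circle_re_neg] at this
    linarith
  · intro h
    refine circle_ext_re_im ?_ ?_
    · rw [circle_re_inv, circle_re_neg, h, neg_zero]
    · rw [circle_im_inv, circle_im_neg]

/-- The point of the unit circle with given coordinates. -/
def circleOfCoords (a b : ℝ) (h : a ^ 2 + b ^ 2 = 1) : Circle :=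
  ⟨⟨a, b⟩, by
    rw [Submonoid.unitSphere, ← SetLike.mem_coe]
    change (⟨a, b⟩ : ℂ) ∈ Metric.sphere (0 : ℂ) 1
    rw [mem_sphere_zero_iff_norm, ← sq_eq_sq₀ (norm_nonneg _) zero_le_one, Complex.sq_norm,
      Complex.normSq_mk]
    linarith⟩

/-- The point of the upper half circle with real part `x`. -/
def halfCircle (x : SymmInterval) : Circle :=
  circleOfCoords x.1 (√(1 - x.1 ^ 2)) (by
    rw [Real.sq_sqrt (by nlinarith [x.2.1, x.2.2])]
    ring)

/-- The point of the first quarter circle whose square has real part `x`. -/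
def quarterCircle (x : SymmInterval) : Circle :=
  circleOfCoords (√((1 + x.1) / 2)) (√((1 - x.1) / 2)) (by
    rw [Real.sq_sqrt (by linarith [x.2.1]), Real.sq_sqrt (by linarith [x.2.2])]
    ring)

theorem halfCircle_re (x : SymmInterval) : (halfCircle x : ℂ).re = x.1 := rfl

theorem halfCircle_im (x : SymmInterval) : (halfCircle x : ℂ).im = √(1 - x.1 ^ 2) := rfl

theorem quarterCircle_re (x : SymmInterval) : (quarterCircle x : ℂ).re = √((1 + x.1) / 2) := rfl

theorem quarterCircle_im (x : SymmInterval) : (quarterCircle x : ℂ).im = √((1 - x.1) / 2) := rfl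

theorem continuous_of_circle_re_im {X : Type} [TopologicalSpace X] {φ : X → Circle}
    (h : Continuous fun x => (φ x : ℂ).re) (h' : Continuous fun x => (φ x : ℂ).im) :
    Continuous φ := by
  refine continuous_induced_rng.2 ?_
  exact Complex.equivRealProdCLM.symm.continuous.comp (h.prodMk h')

theorem continuous_halfCircle : Continuous halfCircle := by
  refine continuous_of_circle_re_im ?_ ?_
  · simp only [halfCircle_re]
    fun_prop
  · simp only [halfCircle_im]
    fun_prop

theorem continuous_quarterCircle : Continuous quarterCircle := by
  refine continuous_of_circle_re_im ?_ ?_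
  · simp only [quarterCircle_re]
    fun_prop
  · simp only [quarterCircle_im]
    fun_prop

theorem halfCircle_inv_eq_iff (x : SymmInterval) :
    (halfCircle x)⁻¹ = halfCircle x ↔ x.1 = 1 ∨ x.1 = -1 := by
  rw [circle_inv_eq_self_iff, halfCircle_im, Real.sqrt_eq_zero (by nlinarith [x.2.1, x.2.2]),
    sub_eq_zero, eq_comm]
  exact sq_eq_one_iff

theorem quarterCircle_inv_eq_iff (x : SymmInterval) :
    (quarterCircle x)⁻¹ = quarterCircle x ↔ x.1 = 1 := by
  rw [circle_inv_eq_self_iff, quarterCircle_im, Real.sqrt_eq_zero (by linarith [x.2.2])]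
  constructor <;> intro h <;> linarith

theorem quarterCircle_inv_eq_neg_iff (x : SymmInterval) :
    (quarterCircle x)⁻¹ = -quarterCircle x ↔ x.1 = -1 := by
  rw [circle_inv_eq_neg_iff, quarterCircle_re, Real.sqrt_eq_zero (by linarith [x.2.1])]
  constructor <;> intro h <;> linarith

theorem exists_halfCircle (z : Circle) :
    ∃ (a : ZMod 2) (x : SymmInterval), involutionPow (·⁻¹) a (halfCircle x) = z := by
  have hsq := circle_sq_add_sq z
  have him : √(1 - (z : ℂ).re ^ 2) = |(z : ℂ).im| := by
    rw [← Real.sqrt_sq_eq_abs]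
    congr 1
    linarith
  rcases le_total 0 (z : ℂ).im with h | h
  · refine ⟨0, ⟨_, circle_re_mem z⟩, circle_ext_re_im rfl ?_⟩
    rw [involutionPow_zero, halfCircle_im, him, abs_of_nonneg h]
  · refine ⟨1, ⟨_, circle_re_mem z⟩, circle_ext_re_im ?_ ?_⟩
    · rw [involutionPow_one, circle_re_inv, halfCircle_re]
    · rw [involutionPow_one, circle_im_inv, halfCircle_im, him, abs_of_nonpos h, neg_neg]

theorem exists_quarterCircle {z : Circle} (hz : 0 ≤ (z : ℂ).re) :
    ∃ (a : ZMod 2) (x : SymmInterval), involutionPow (·⁻¹) a (quarterCircle x) = z := by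
  have hsq := circle_sq_add_sq z
  -- By the double angle formula this is the real part of `z ^ 2`.
  let x : SymmInterval := ⟨2 * (z : ℂ).re ^ 2 - 1, by nlinarith, by nlinarith⟩
  have hre : (quarterCircle x : ℂ).re = (z : ℂ).re := by
    rw [quarterCircle_re, ← Real.sqrt_sq hz]
    congr 1
    change (1 + (2 * (z : ℂ).re ^ 2 - 1)) / 2 = (z : ℂ).re ^ 2
    ring
  have him : (quarterCircle x : ℂ).im = |(z : ℂ).im| := by
    rw [quarterCircle_im, ← Real.sqrt_sq_eq_abs]
    congr 1
    change (1 - (2 * (z : ℂ).re ^ 2 - 1)) / 2 = _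
    linarith
  rcases le_total 0 (z : ℂ).im with h | h
  · refine ⟨0, x, circle_ext_re_im hre ?_⟩
    rw [involutionPow_zero, him, abs_of_nonneg h]
  · refine ⟨1, x, circle_ext_re_im ?_ ?_⟩
    · rw [involutionPow_one, circle_re_inv, hre]
    · rw [involutionPow_one, circle_im_inv, him, abs_of_nonpos h, neg_neg]

theorem isCommutingInvolutions_torusConj : IsCommutingInvolutions torusConj₁ torusConj₂ where
  involutive₁ z := Prod.ext (inv_inv z.1) rfl
  involutive₂ z := Prod.ext rfl (inv_inv z.2)
  comm _ := rfl

theorem fibreAct_torusConj (g : Z23) (z : Torus) : fibreAct torusConj₁ torusConj₂ g z =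
    (involutionPow (·⁻¹) (g 0) z.1, involutionPow (·⁻¹) (g 1) z.2) := by
  unfold fibreAct
  rcases g.apply_eq_zero_or_one 0 with h | h <;> rcases g.apply_eq_zero_or_one 1 with h' | h' <;>
    rw [h, h'] <;> rfl

theorem circle_re_involutionPow (a : ZMod 2) (z : Circle) :
    ((involutionPow (·⁻¹) a z : Circle) : ℂ).re = (z : ℂ).re := by
  rcases ZMod.eq_zero_or_one a with rfl | rfl
  · rfl
  · exact circle_re_inv z

/-- An element of the subgroup generated by two elements of `(ℤ₂)³`. -/
theorem Z23.mem_of_smul_mem {V : Submodule (ZMod 2) Z23} {g : Z23} (h2 : g 2 = 0)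
    (h0 : g 0 = 1 → basisVec 0 ∈ V) (h1 : g 1 = 1 → basisVec 1 ∈ V) : g ∈ V := by
  rw [g.eq_sum_basisVec, h2, zero_smul, add_zero]
  refine V.add_mem ?_ ?_
  · rcases g.apply_eq_zero_or_one 0 with h | h
    · rw [h, zero_smul]
      exact V.zero_mem
    · exact V.smul_mem _ (h0 h)
  · rcases g.apply_eq_zero_or_one 1 with h | h
    · rw [h, zero_smul]
      exact V.zero_mem
    · exact V.smul_mem _ (h1 h)

theorem mem_faceGroup_of_mem {lam : PrismFacet → Z23} {x : Prism4} (i : PrismFacet)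
    (hx : x ∈ prismFacet i) : lam i ∈ faceGroup prismFacet lam x :=
  Submodule.subset_span ⟨i, hx, rfl⟩

/-- The real parts of `z₁` and `z₂` are invariant under both conjugations and recover the point of
the square; conjugation fixes a point of the half circle only at the ends `±1`. -/
theorem isFundamentalSquare_torus {lam : PrismFacet → Z23} {w : Z23}
    (hs : ∀ k, lam (.side k) = ![basisVec 0, basisVec 1, basisVec 0, basisVec 1] k)
    (hb : lam .bottom = basisVec 2) (ht : lam .top = w) (hw : w 2 = 1) :
    IsFundamentalSquare lam torusConj₁ torusConj₂ w
      fun p => (halfCircle p.1, halfCircle p.2) where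
  invol := isCommutingInvolutions_torusConj
  continuous₁ := by
    unfold torusConj₁
    fun_prop
  continuous₂ := by
    unfold torusConj₂
    fun_prop
  continuous_param := (continuous_halfCircle.comp continuous_fst).prodMk
    (continuous_halfCircle.comp continuous_snd)
  exists_eq := by
    rintro ⟨z₁, z₂⟩
    obtain ⟨a, x, rfl⟩ := exists_halfCircle z₁
    obtain ⟨b, y, rfl⟩ := exists_halfCircle z₂
    exact ⟨![a, b, 0], (x, y), fibreAct_torusConj _ _⟩
  eq_of_fibreAct_eq := by
    intro g p p' h
    rw [fibreAct_torusConj] at h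
    have h1 := congrArg (fun z : Torus => (z.1 : ℂ).re) h
    have h2 := congrArg (fun z : Torus => (z.2 : ℂ).re) h
    simp only [circle_re_involutionPow, halfCircle_re] at h1 h2
    exact Prod.ext (Subtype.ext h1) (Subtype.ext h2)
  mem_faceGroup := by
    intro g x hg h
    rw [fibreAct_torusConj] at h
    have h1 := congrArg Prod.fst h
    have h2 := congrArg Prod.snd h
    refine Z23.mem_of_smul_mem hg (fun h' => ?_) (fun h' => ?_)
    · simp only [h', involutionPow_one] at h1
      rcases (halfCircle_inv_eq_iff _).1 h1 with e | e
      · simpa [hs] using mem_faceGroup_of_mem (lam := lam) (.side 0) e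
      · simpa [hs] using mem_faceGroup_of_mem (lam := lam) (.side 2) e
    · simp only [h', involutionPow_one] at h2
      rcases (halfCircle_inv_eq_iff _).1 h2 with e | e
      · simpa [hs] using mem_faceGroup_of_mem (lam := lam) (.side 1) e
      · simpa [hs] using mem_faceGroup_of_mem (lam := lam) (.side 3) e
  side_height := by
    intro k
    rw [hs]
    fin_cases k <;> rfl
  fibreAct_side := by
    intro k x hx
    rw [hs, fibreAct_torusConj]
    fin_cases k
    · exact Prod.ext ((halfCircle_inv_eq_iff _).2 (Or.inl hx)) rfl
    · exact Prod.ext rfl ((halfCircle_inv_eq_iff _).2 (Or.inl hx))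
    · exact Prod.ext ((halfCircle_inv_eq_iff _).2 (Or.inr hx)) rfl
    · exact Prod.ext rfl ((halfCircle_inv_eq_iff _).2 (Or.inr hx))
  bottom_eq := hb
  top_eq := ht
  twist_height := hw

/-! ### The Klein bottle -/

/-- The class `[z₁, z₂]` in the Klein bottle. -/
def Klein.mk (z : Torus) : Klein := Quot.mk KleinRel z

theorem Klein.continuous_mk : Continuous Klein.mk := continuous_quot_mk

theorem Klein.mk_rel (z : Torus) : Klein.mk (-z.1, z.2⁻¹) = Klein.mk z :=
  (Quot.sound (KleinRel.rel z)).symm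

/-- The map `[z₁, z₂] ↦ (z₁², Re z₂, z₁ Im z₂)`, which embeds the Klein bottle in `ℂ × ℝ × ℂ`. -/
def kleinEmbed : Klein → ℂ × ℝ × ℂ :=
  Quot.lift (fun z : Torus => ((z.1 : ℂ) ^ 2, (z.2 : ℂ).re, (z.1 : ℂ) * ((z.2 : ℂ).im : ℂ))) (by
    rintro z _ ⟨⟩
    simp only [circle_re_inv, circle_im_inv, Circle.coe_neg, neg_sq, Complex.ofReal_neg,
      neg_mul_neg])

theorem continuous_kleinEmbed : Continuous kleinEmbed := by
  refine continuous_coinduced_dom.2 ?_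
  change Continuous fun z : Torus =>
    ((z.1 : ℂ) ^ 2, (z.2 : ℂ).re, (z.1 : ℂ) * ((z.2 : ℂ).im : ℂ))
  fun_prop

/-- The first coordinate fixes `z₁` up to sign, the second fixes `z₂` up to conjugation, and the
product `z₁ Im z₂` ties the two choices together. -/
theorem Klein.eq_or_of_embed_eq {z w : Torus}
    (h : kleinEmbed (Klein.mk z) = kleinEmbed (Klein.mk w)) :
    z = w ∨ z = (-w.1, w.2⁻¹) := by
  have h1 : (z.1 : ℂ) ^ 2 = (w.1 : ℂ) ^ 2 := congrArg Prod.fst h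
  have h2 : (z.2 : ℂ).re = (w.2 : ℂ).re := congrArg (fun p => p.2.1) h
  have h3 : (z.1 : ℂ) * ((z.2 : ℂ).im : ℂ) = (w.1 : ℂ) * ((w.2 : ℂ).im : ℂ) :=
    congrArg (fun p => p.2.2) h
  rcases sq_eq_sq_iff_eq_or_eq_neg.1 h1 with e | e
  · left
    rw [e] at h3
    exact Prod.ext (Circle.ext e) (circle_ext_re_im h2
      (Complex.ofReal_injective (mul_left_cancel₀ (Circle.coe_ne_zero _) h3)))
  · right
    rw [e, neg_mul, ← mul_neg, ← Complex.ofReal_neg] at h3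
    have h4 := Complex.ofReal_injective (mul_left_cancel₀ (Circle.coe_ne_zero _) h3)
    refine Prod.ext (Circle.ext (by rw [e, Circle.coe_neg])) (circle_ext_re_im ?_ ?_)
    · rw [circle_re_inv, h2]
    · rw [circle_im_inv, ← h4, neg_neg]

theorem injective_kleinEmbed : Function.Injective kleinEmbed := by
  rintro ⟨z⟩ ⟨w⟩ h
  rcases Klein.eq_or_of_embed_eq h with rfl | rfl
  · rfl
  · exact Klein.mk_rel w

instance : T2Space Klein :=
  T2Space.of_injective_continuous injective_kleinEmbed continuous_kleinEmbed

theorem kleinConj₁_mk (z : Torus) : kleinConj₁ (Klein.mk z) = Klein.mk (torusConj₁ z) := by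
  refine congrArg Klein.mk (Prod.ext ?_ ?_) <;> simp [torusConj₁]

theorem kleinConj₂_mk (z : Torus) : kleinConj₂ (Klein.mk z) = Klein.mk (torusConj₂ z) := by
  refine congrArg Klein.mk (Prod.ext ?_ ?_) <;> simp [torusConj₂]

theorem isCommutingInvolutions_kleinConj : IsCommutingInvolutions kleinConj₁ kleinConj₂ where
  involutive₁ := kleinMap_kleinMap _ _
  involutive₂ := kleinMap_kleinMap _ _
  comm := by
    rintro ⟨z⟩
    change kleinConj₁ (kleinConj₂ (Klein.mk z)) = kleinConj₂ (kleinConj₁ (Klein.mk z))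
    rw [kleinConj₂_mk, kleinConj₁_mk, kleinConj₁_mk, kleinConj₂_mk]
    rfl

theorem fibreAct_kleinConj (g : Z23) (z : Torus) :
    fibreAct kleinConj₁ kleinConj₂ g (Klein.mk z) =
      Klein.mk (involutionPow (·⁻¹) (g 0) z.1, involutionPow (·⁻¹) (g 1) z.2) := by
  rw [← fibreAct_torusConj]
  unfold fibreAct
  rcases g.apply_eq_zero_or_one 0 with h | h <;> rcases g.apply_eq_zero_or_one 1 with h' | h' <;>
    rw [h, h'] <;> simp only [involutionPow_zero, involutionPow_one, kleinConj₁_mk, kleinConj₂_mk]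

theorem quarterCircle_sq_re (x : SymmInterval) : ((quarterCircle x : ℂ) ^ 2).re = x.1 := by
  rw [sq, Complex.mul_re, quarterCircle_re, quarterCircle_im,
    Real.mul_self_sqrt (by linarith [x.2.1]), Real.mul_self_sqrt (by linarith [x.2.2])]
  ring

theorem circle_sq_re_involutionPow (a : ZMod 2) (z : Circle) :
    ((((involutionPow (·⁻¹) a z : Circle)) : ℂ) ^ 2).re = ((z : ℂ) ^ 2).re := by
  rcases ZMod.eq_zero_or_one a with rfl | rfl
  · rfl
  · rw [involutionPow_one, sq, sq, Complex.mul_re, Complex.mul_re, circle_re_inv, circle_im_inv,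
      neg_mul_neg]

/-- Here the invariants that recover the point of the square are `Re z₁²` and `Re z₂`. A quarter
circle suffices because `[z₁, z₂] = [-z₁, z̄₂]` allows `Re z₁ ≥ 0`. -/
theorem isFundamentalSquare_klein {lam : PrismFacet → Z23} {w : Z23}
    (hs : ∀ k, lam (.side k) = ![basisVec 0, basisVec 1, basisVec 0 + basisVec 1, basisVec 1] k)
    (hb : lam .bottom = basisVec 2) (ht : lam .top = w) (hw : w 2 = 1) :
    IsFundamentalSquare lam kleinConj₁ kleinConj₂ w
      fun p => Klein.mk (quarterCircle p.1, halfCircle p.2) where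
  invol := isCommutingInvolutions_kleinConj
  continuous₁ := continuous_kleinMap _ _
  continuous₂ := continuous_kleinMap _ _
  continuous_param := Klein.continuous_mk.comp
    ((continuous_quarterCircle.comp continuous_fst).prodMk
      (continuous_halfCircle.comp continuous_snd))
  exists_eq := by
    have key : ∀ z : Torus, 0 ≤ (z.1 : ℂ).re → ∃ (g : Z23)
        (p : SymmInterval × SymmInterval), fibreAct kleinConj₁ kleinConj₂ g
        (Klein.mk (quarterCircle p.1, halfCircle p.2)) = Klein.mk z := by
      rintro ⟨z₁, z₂⟩ hz
      obtain ⟨a, x, rfl⟩ := exists_quarterCircle hz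
      obtain ⟨b, y, rfl⟩ := exists_halfCircle z₂
      exact ⟨![a, b, 0], (x, y), fibreAct_kleinConj _ _⟩
    rintro ⟨z⟩
    rcases le_total 0 (z.1 : ℂ).re with h | h
    · exact key z h
    · obtain ⟨g, p, e⟩ := key (-z.1, z.2⁻¹) (by
        rw [circle_re_neg]
        linarith)
      exact ⟨g, p, e.trans (Klein.mk_rel z)⟩
  eq_of_fibreAct_eq := by
    intro g p p' h
    rw [fibreAct_kleinConj] at h
    have h1 : ((involutionPow (·⁻¹) (g 0) (quarterCircle p.1) : Circle) : ℂ) ^ 2 =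
      (quarterCircle p'.1 : ℂ) ^ 2 := congrArg (fun z => (kleinEmbed z).1) h
    have h2 : ((involutionPow (·⁻¹) (g 1) (halfCircle p.2) : Circle) : ℂ).re =
      (halfCircle p'.2 : ℂ).re := congrArg (fun z => (kleinEmbed z).2.1) h
    have h1' := congrArg Complex.re h1
    rw [circle_sq_re_involutionPow, quarterCircle_sq_re, quarterCircle_sq_re] at h1'
    rw [circle_re_involutionPow, halfCircle_re, halfCircle_re] at h2
    exact Prod.ext (Subtype.ext h1') (Subtype.ext h2)
  mem_faceGroup := by
    intro g x hg h
    have side1 : (halfCircle (prismBase x).2)⁻¹ = halfCircle (prismBase x).2 →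
        basisVec 1 ∈ faceGroup prismFacet lam x := by
      intro h'
      rcases (halfCircle_inv_eq_iff _).1 h' with e | e
      · simpa [hs] using mem_faceGroup_of_mem (lam := lam) (.side 1) e
      · simpa [hs] using mem_faceGroup_of_mem (lam := lam) (.side 3) e
    rw [fibreAct_kleinConj] at h
    rcases Klein.eq_or_of_embed_eq (congrArg kleinEmbed h) with h | h
    · have h1 := congrArg Prod.fst h
      have h2 := congrArg Prod.snd h
      refine Z23.mem_of_smul_mem hg (fun h' => ?_) (fun h' => ?_)
      · simp only [h', involutionPow_one] at h1
        have e := (quarterCircle_inv_eq_iff _).1 h1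
        simpa [hs] using mem_faceGroup_of_mem (lam := lam) (.side 0) e
      · simp only [h', involutionPow_one] at h2
        exact side1 h2
    -- The point is fixed only up to the Klein relation. Then `g` must conjugate `z₁`, as `z₁ ≠
    -- -z₁`, and `z̄₁ = -z₁` puts the point on side 2, of color `e₁ + e₂`. If `g` does not conjugate
    -- `z₂`, then `z₂` is real, so `e₂`, and with it `e₁`, is in the face group.
    · have h1 := congrArg Prod.fst h
      have h2 := congrArg Prod.snd h
      simp only at h1 h2
      rcases g.apply_eq_zero_or_one 0 with h0 | h0
      · rw [h0, involutionPow_zero] at h1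
        exact absurd h1 fun e => Circle.coe_ne_zero (quarterCircle (prismBase x).1)
          (self_eq_neg.1 ((congrArg Subtype.val e).trans (Circle.coe_neg _)))
      · rw [h0, involutionPow_one] at h1
        have e := (quarterCircle_inv_eq_neg_iff _).1 h1
        have hmem : basisVec 0 + basisVec 1 ∈ faceGroup prismFacet lam x := by
          simpa [hs] using mem_faceGroup_of_mem (lam := lam) (.side 2) e
        rw [g.eq_sum_basisVec, hg, zero_smul, add_zero, h0, one_smul]
        rcases g.apply_eq_zero_or_one 1 with h1' | h1'
        · rw [h1', involutionPow_zero] at h2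
          rw [h1', zero_smul, add_zero]
          have := (faceGroup prismFacet lam x).sub_mem hmem (side1 h2.symm)
          rwa [add_sub_cancel_right] at this
        · rwa [h1', one_smul]
  side_height := by
    intro k
    rw [hs]
    fin_cases k <;> rfl
  fibreAct_side := by
    intro k x hx
    rw [hs, fibreAct_kleinConj]
    fin_cases k
    · exact congrArg _ (Prod.ext ((quarterCircle_inv_eq_iff _).2 hx) rfl)
    · exact congrArg _ (Prod.ext rfl ((halfCircle_inv_eq_iff _).2 (Or.inl hx)))
    · have h := (quarterCircle_inv_eq_neg_iff (prismBase x).1).2 hx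
      change Klein.mk (involutionPow _ ((basisVec 0 + basisVec 1 : Z23) 0) _,
        involutionPow _ ((basisVec 0 + basisVec 1 : Z23) 1) _) = _
      rw [show (basisVec 0 + basisVec 1 : Z23) 0 = 1 by decide,
        show (basisVec 0 + basisVec 1 : Z23) 1 = 1 by decide, involutionPow_one, involutionPow_one,
        h]
      exact Klein.mk_rel (quarterCircle (prismBase x).1, halfCircle (prismBase x).2)
    · exact congrArg _ (Prod.ext rfl ((halfCircle_inv_eq_iff _).2 (Or.inr hx)))
  bottom_eq := hb
  top_eq := ht
  twist_height := hw

/-! ## Nontriviality of the bundles -/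

/-- The power map `z ↦ z ^ n` of the circle is not nullhomotopic for `n ≠ 0`. -/
theorem circle_zpow_not_nullhomotopic {n : ℤ} (hn : n ≠ 0) (H : C(unitInterval × Circle, Circle))
    (h0 : ∀ z, H (0, z) = 1) : ¬ ∀ z, H (1, z) = z ^ n := by
  intro h1
  have hH : ∀ z, H (0, z) = Circle.exp ((ContinuousMap.const Circle (0 : ℝ)) z) := fun z => by
    rw [h0, ContinuousMap.const_apply, Circle.exp_zero]
  let L := Circle.isCoveringMap_exp.liftHomotopy H (ContinuousMap.const Circle 0) hH
  have hL : ∀ p, Circle.exp (L p) = H p :=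
    congrFun (Circle.isCoveringMap_exp.liftHomotopy_lifts H _ hH)
  -- The function `φ` lifts the constant `1`, so it is constant. Since `L (1, ·)` is defined on the
  -- circle, comparing `2π` with `0` gives `2πn = 0`.
  let φ : ℝ → ℝ := fun t => L (1, Circle.exp t) - n * t
  have hφ : Continuous φ := by fun_prop
  have hone : ∀ t, Circle.exp (φ t) = 1 := fun t => by
    rw [Circle.exp_sub, hL, h1, ← zsmul_eq_mul, Circle.exp_zsmul, div_self']
  have h := Circle.isCoveringMap_exp.const_of_comp hφ (fun s t => (hone s).trans (hone t).symm)
    (2 * Real.pi) 0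
  simp only [φ, Circle.exp_two_pi, Circle.exp_zero, mul_zero, sub_zero] at h
  have : (n : ℝ) * (2 * Real.pi) = 0 := by linarith
  simp [hn, Real.pi_ne_zero] at this

/-- Pointwise multiplication by `z ^ (-m)` turns the homotopy into one from the constant `1` to `z ^
(n - m)`. -/
theorem circle_zpow_homotopy_absurd {m n : ℤ} (hmn : m ≠ n)
    (H : C(unitInterval × Circle, Circle)) (h0 : ∀ z, H (0, z) = z ^ m)
    (h1 : ∀ z, H (1, z) = z ^ n) : False := by
  refine circle_zpow_not_nullhomotopic (sub_ne_zero.2 hmn.symm)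
    ⟨fun p => H p * (p.2 ^ m)⁻¹, by fun_prop⟩ (fun z => ?_) fun z => ?_
  · change H (0, z) * (z ^ m)⁻¹ = 1
    rw [h0, mul_inv_cancel]
  · change H (1, z) * (z ^ m)⁻¹ = _
    rw [h1, zpow_sub]

/-- If the mapping torus of `f` is a trivial bundle, then `f` is homotopic to the identity. -/
theorem exists_homotopy_of_trivial {F : Type} [TopologicalSpace F] {f : F ≃ₜ F}
    (h : IsHomeomorphicTrivialFiberBundle F (MappingTorus.proj f)) :
    ∃ H : C(unitInterval × F, F), (∀ x, H (0, x) = x) ∧ ∀ x, H (1, x) = f x := by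
  obtain ⟨e, he⟩ := h
  let c : unitInterval → SymmInterval := fun t =>
    ⟨2 * t.1 - 1, by linarith [t.2.1], by linarith [t.2.2]⟩
  let φ : F × SymmInterval → F := fun p => (e (MappingTorus.mk f p)).2
  have hφ : Continuous φ := continuous_snd.comp (e.continuous.comp (MappingTorus.continuous_mk f))
  let ψ : F → MappingTorus f := fun y => e.symm (Circle.exp (Real.pi * (-1)), y)
  have hψ : Continuous ψ := e.symm.continuous.comp (by fun_prop)
  have hmem : ∀ y, ψ y ∈ MappingTorus.proj f ⁻¹' {z | z ≠ Circle.exp (Real.pi * 0)} := by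
    intro y
    change MappingTorus.proj f (ψ y) ≠ _
    rw [← he, e.apply_symm_apply, ← circle_exp_pi_mul_add_two,
      show (-1 + 2 : ℝ) = 1 by norm_num]
    exact circle_exp_pi_mul_one_ne
  -- This is the inverse of the trivialization on the fibre over `-1`. The chart at `c = 0` is used
  -- because the one at `c = 1` omits that fibre; it reads `(x, -1)` as `f⁻¹ x`, hence the outer
  -- `f`.
  let r : F → F := fun y => f (MappingTorus.fibreCoord f 0 (by norm_num) (ψ y))
  have hr : Continuous r := f.continuous.comp
    ((MappingTorus.continuousOn_fibreCoord f 0 (by norm_num)).comp_continuous hψ hmem)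
  have hstart : ∀ x, r (φ (x, ⟨-1, by norm_num⟩)) = x := by
    intro x
    have : ψ (φ (x, ⟨-1, by norm_num⟩)) = MappingTorus.mk f (x, ⟨-1, by norm_num⟩) :=
      e.symm_apply_eq.2 (Prod.ext (by rw [he, MappingTorus.proj_mk]) rfl)
    simp only [r]
    rw [this, MappingTorus.fibreCoord_mk, if_neg (by norm_num), f.apply_symm_apply]
  refine ⟨⟨fun p => r (φ (p.2, c p.1)), hr.comp (hφ.comp (by fun_prop))⟩, fun x => ?_, fun x => ?_⟩
  · have hc : c 0 = ⟨-1, by norm_num⟩ := Subtype.ext (by norm_num [c])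
    change r (φ (x, c 0)) = x
    rw [hc, hstart]
  · have hc : c 1 = ⟨1, by norm_num⟩ := Subtype.ext (by norm_num [c])
    change r (φ (x, c 1)) = f x
    -- The ends are glued, so `φ` takes the same value at `(x, 1)` and `(f x, -1)`, and `r` returns
    -- `f x`.
    rw [hc, ← hstart (f x)]
    simp only [φ]
    rw [MappingTorus.mk_glue]

/-- A homeomorphism that changes the degree of the composite of a loop `ι` with a map `π` to the
circle is the monodromy of a nontrivial bundle. -/
theorem isNontrivialBundle_of_degree_ne {F : Type} [TopologicalSpace F] (f : F ≃ₜ F)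
    {m n : ℤ} (hmn : m ≠ n) {ι : Circle → F} (hι : Continuous ι) {π : F → Circle}
    (hπ : Continuous π) (h0 : ∀ z, π (ι z) = z ^ m) (h1 : ∀ z, π (f (ι z)) = z ^ n) :
    IsNontrivialBundle f := by
  intro h
  obtain ⟨H, hH0, hH1⟩ := exists_homotopy_of_trivial h
  refine circle_zpow_homotopy_absurd hmn ⟨fun p => π (H (p.1, ι p.2)), by fun_prop⟩
    (fun z => ?_) fun z => ?_
  · change π (H (0, ι z)) = _
    rw [hH0, h0]
  · change π (H (1, ι z)) = _
    rw [hH1, h1]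

theorem isNontrivialBundle_torus₁ (b : ℤˣ) : IsNontrivialBundle (torusHomeo (diagGL (-1) b)) := by
  refine isNontrivialBundle_of_degree_ne _ (m := 1) (n := -1) (by decide)
    (ι := fun z => (z, 1)) (by fun_prop) (π := Prod.fst) continuous_fst (fun z => (zpow_one z).symm)
    fun z => ?_
  change z ^ (-1 : ℤ) * 1 ^ (0 : ℤ) = _
  rw [one_zpow, mul_one]

theorem isNontrivialBundle_torus₂ (a : ℤˣ) : IsNontrivialBundle (torusHomeo (diagGL a (-1))) := by
  refine isNontrivialBundle_of_degree_ne _ (m := 1) (n := -1) (by decide)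
    (ι := fun z => (1, z)) (by fun_prop) (π := Prod.snd) continuous_snd (fun z => (zpow_one z).symm)
    fun z => ?_
  change 1 ^ (0 : ℤ) * z ^ (-1 : ℤ) = _
  rw [one_zpow, one_mul]

/-- The map `[z₁, z₂] ↦ z₁²` from the Klein bottle to the circle. -/
def kleinSquare : Klein → Circle :=
  Quot.lift (fun z : Torus => z.1 ^ (2 : ℤ)) (by
    rintro z _ ⟨⟩
    exact (even_two.neg_zpow z.1).symm)

theorem continuous_kleinSquare : Continuous kleinSquare := by
  refine continuous_coinduced_dom.2 ?_
  change Continuous fun z : Torus => z.1 ^ (2 : ℤ)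
  fun_prop

/-- The loop `[z, 1]` has degree `2` under `[z₁, z₂] ↦ z₁²`, and inverting `z₁` changes this to
`-2`, whatever the second sign. -/
theorem isNontrivialBundle_klein (b : ℤˣ) : IsNontrivialBundle (kleinHomeo (-1) b) := by
  refine isNontrivialBundle_of_degree_ne _ (m := 2) (n := -2) (by decide)
    (ι := fun z => Klein.mk (z, 1)) (Klein.continuous_mk.comp (by fun_prop))
    (π := kleinSquare) continuous_kleinSquare (fun z => rfl) fun z => ?_
  change (z ^ (-1 : ℤ)) ^ (2 : ℤ) = _
  rw [← zpow_mul]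
  rfl

/-! ### The bundles belonging to the six colorings. -/

theorem torusHomeo_diagGL_apply (a b : ℤˣ) (z : Torus) :
    torusHomeo (diagGL a b) z = (z.1 ^ (a : ℤ), z.2 ^ (b : ℤ)) := by
  change (z.1 ^ (a : ℤ) * z.2 ^ (0 : ℤ), z.1 ^ (0 : ℤ) * z.2 ^ (b : ℤ)) = _
  rw [zpow_zero, zpow_zero, mul_one, one_mul]

theorem isEquivariantBundle_torus {lam : PrismFacet → Z23} {w : Z23} {a b : ℤˣ}
    (hs : ∀ k, lam (.side k) = ![basisVec 0, basisVec 1, basisVec 0, basisVec 1] k)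
    (hb : lam .bottom = basisVec 2) (ht : lam .top = w) (hw : w 2 = 1)
    (ha : ∀ z : Circle, z ^ (a : ℤ) = involutionPow (·⁻¹) (w 0) z)
    (hb' : ∀ z : Circle, z ^ (b : ℤ) = involutionPow (·⁻¹) (w 1) z) :
    IsEquivariantBundle lam torusConj₁ torusConj₂ (torusHomeo (diagGL a b)) :=
  (isFundamentalSquare_torus hs hb ht hw).isEquivariantBundle _ fun z => by
    rw [torusHomeo_diagGL_apply, fibreAct_torusConj, ha, hb']

theorem isEquivariantBundle_klein {lam : PrismFacet → Z23} {w : Z23} {a b : ℤˣ}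
    (hs : ∀ k, lam (.side k) = ![basisVec 0, basisVec 1, basisVec 0 + basisVec 1, basisVec 1] k)
    (hb : lam .bottom = basisVec 2) (ht : lam .top = w) (hw : w 2 = 1)
    (ha : ∀ z : Circle, z ^ (a : ℤ) = involutionPow (·⁻¹) (w 0) z)
    (hb' : ∀ z : Circle, z ^ (b : ℤ) = involutionPow (·⁻¹) (w 1) z) :
    IsEquivariantBundle lam kleinConj₁ kleinConj₂ (kleinHomeo a b) :=
  (isFundamentalSquare_klein hs hb ht hw).isEquivariantBundle _ (by
    rintro ⟨z⟩
    refine Eq.trans ?_ (fibreAct_kleinConj w z).symm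
    change Klein.mk (z.1 ^ (a : ℤ), z.2 ^ (b : ℤ)) = _
    rw [ha, hb'])

theorem circle_zpow_units_one {c : ZMod 2} (hc : c = 0) (z : Circle) :
    z ^ ((1 : ℤˣ) : ℤ) = involutionPow (·⁻¹) c z := by
  rw [hc, involutionPow_zero, Units.val_one, zpow_one]

theorem circle_zpow_units_neg_one {c : ZMod 2} (hc : c = 1) (z : Circle) :
    z ^ ((-1 : ℤˣ) : ℤ) = involutionPow (·⁻¹) c z := by
  rw [hc, involutionPow_one, Units.val_neg, Units.val_one, zpow_neg_one]

end

theorem mainTheorem7 :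
    -- the colored prisms: `τ₁, …, τ₆` are colorings of the required kind, and up to
    -- `GL(3, ℤ₂)` and rotation of the side facets there are no others
    ((∀ j : Fin 6, IsTwistColoring (tau j)) ∧
      (∀ lam : PrismFacet → Z23, IsTwistColoring lam →
        ∃ (σ : Z23 ≃ₗ[ZMod 2] Z23) (r : Fin 4) (j : Fin 6),
          ∀ F : PrismFacet, lam F = σ (tau j (rotateFacet r F)))) ∧
    -- the torus bundles
    (IsEquivariantBundle (tau 0) torusConj₁ torusConj₂ (torusHomeo (diagGL (-1) 1)) ∧
      IsEquivariantBundle (tau 1) torusConj₁ torusConj₂ (torusHomeo (diagGL 1 (-1))) ∧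
      IsEquivariantBundle (tau 2) torusConj₁ torusConj₂ (torusHomeo (diagGL (-1) (-1)))) ∧
    -- the Klein bottle bundles
    (IsEquivariantBundle (tau 3) kleinConj₁ kleinConj₂ (kleinHomeo (-1) 1) ∧
      IsEquivariantBundle (tau 4) kleinConj₁ kleinConj₂ (kleinHomeo 1 (-1)) ∧
      IsEquivariantBundle (tau 5) kleinConj₁ kleinConj₂ (kleinHomeo (-1) (-1))) ∧
    -- nontriviality
    (IsNontrivialBundle (torusHomeo (diagGL (-1) 1)) ∧
      IsNontrivialBundle (torusHomeo (diagGL 1 (-1))) ∧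
      IsNontrivialBundle (torusHomeo (diagGL (-1) (-1))) ∧
      IsNontrivialBundle (kleinHomeo (-1) 1) ∧
      IsNontrivialBundle (kleinHomeo (-1) (-1))) := by
  have sides_t : ∀ j : Fin 3, ∀ k, tau (Fin.castLE (by decide) j) (.side k) =
      ![basisVec 0, basisVec 1, basisVec 0, basisVec 1] k := by decide +kernel
  have sides_k : ∀ j : Fin 3, ∀ k, tau (Fin.natAdd 3 j) (.side k) =
      ![basisVec 0, basisVec 1, basisVec 0 + basisVec 1, basisVec 1] k := by decide +kernel
  refine ⟨⟨isTwistColoring_tau, fun lam => exists_eq_tau_rotateFacet⟩, ⟨?_, ?_, ?_⟩, ⟨?_, ?_, ?_⟩,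
    isNontrivialBundle_torus₁ 1, isNontrivialBundle_torus₂ 1, isNontrivialBundle_torus₁ (-1),
    isNontrivialBundle_klein 1, isNontrivialBundle_klein (-1)⟩
  · exact isEquivariantBundle_torus (sides_t 0) rfl rfl (by decide)
      (circle_zpow_units_neg_one (by decide)) (circle_zpow_units_one (by decide))
  · exact isEquivariantBundle_torus (sides_t 1) rfl rfl (by decide)
      (circle_zpow_units_one (by decide)) (circle_zpow_units_neg_one (by decide))
  · exact isEquivariantBundle_torus (sides_t 2) rfl rfl (by decide)
      (circle_zpow_units_neg_one (by decide)) (circle_zpow_units_neg_one (by decide))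
  · exact isEquivariantBundle_klein (sides_k 0) rfl rfl (by decide)
      (circle_zpow_units_neg_one (by decide)) (circle_zpow_units_one (by decide))
  · exact isEquivariantBundle_klein (sides_k 1) rfl rfl (by decide)
      (circle_zpow_units_one (by decide)) (circle_zpow_units_neg_one (by decide))
  · exact isEquivariantBundle_klein (sides_k 2) rfl rfl (by decide)
      (circle_zpow_units_neg_one (by decide)) (circle_zpow_units_neg_one (by decide))
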